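/- Consider a Markov decision process with finite state space $\mathcal X$, finite action space $\mathcal A$, transition probabilities $P(x'\mid a,x)$ and reward function $r:\mathcal X\times\mathcal A\to\mathbb R$ (automatically bounded), together with a policy $\pi(a\mid x)$. Assume that the state chain with transition matrix $P_\pi(x'\mid x)=\sum_a \pi(a\mid x)P(x'\mid a,x)$ is irreducible and aperiodic, and let $\mu$ be its stationary distribution. Let $\gamma\in(0,1)$, let $\phi:\mathcal X\to\mathbb R^d$ satisfy $\|\phi(x)\|\le 1$ for all $x$, and assume that the matrix $\Phi=[\phi(x)^\top]_{x\in\mathcal X}$ has full column rank $d$. Let $(x_n,a_n)_{n\ge1}$ be a trajectory of the process under $\pi$, with an arbitrary law of $x_1$ (for instance $\mu$), and write $\phi_n=\phi(x_n)$, $r_n=r(x_n,a_n)$. Let $\alpha_n=c\,n^{-s}$ with $c>0$ and $s\in(1/2,1]$. Let $\mathbb E_\infty$ denote expectation with respect to the two-sided stationary version $(x_n,a_n)_{n\in\mathbb Z}$ of the process, with $x_n\sim\mu$. (i) Implicit TD(0). The equation $\mathbb E_\infty(\phi_n\phi_n^\top-\gamma\phi_n\phi_{n+1}^\top)\,w=\mathbb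 E_\infty(r_n\phi_n)$ has a unique solution $w_*$. For every deterministic $w_1\in\mathbb R^d$, if $$w_{n+1}=w_n+\alpha_n\bigl(r_n+\gamma\phi_{n+1}^\top w_n-\phi_n^\top w_{n+1}\bigr)\phi_n,\qquad n\ge1,$$ then $\mathbb E\|w_n-w_*\|^2<\infty$ for all $n\ge 1$ and $\lim_{n\to\infty}\mathbb E\|w_n-w_*\|^2=0$. (ii) Implicit TD($\lambda$), $\lambda\in[0,1]$. With $e_{-\infty:n}=\sum_{k\ge0}(\lambda\gamma)^k\phi_{n-k}$, the equation $\mathbb E_\infty(e_{-\infty:n}\phi_n^\top-\gamma e_{-\infty:n}\phi_{n+1}^\top)\,w=\mathbb E_\infty(r_n e_{-\infty:n})$ has a unique solution $w_*$. For every deterministic $w_1\in\mathbb R^d$, if $e_0=0$, $e_n=\phi_n+\lambda\gamma e_{n-1}$ and $$w_{n+1}=w_n+\alpha_n\bigl(r_n+\gamma\phi_{n+1}^\top w_n+\lambda\gamma e_{n-1}^\top w_n-e_n^\top w_{n+1}\bigr)e_n,\qquad n\ge1,$$ then $\mathbb E\|w_n-w_*\|^2<\infty$ for all $n\ge 1$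 and $\lim_{n\to\infty}\mathbb E\|w_n-w_*\|^2=0$. -/

import Mathlib

open MeasureTheory Filter Topology
open scoped Matrix

/-- A Markov decision process with state space `X` and action space `A`: transition probabilities
`trans b y y'` (from state `y` to state `y'` under action `b`) and a reward function. -/
structure FiniteMDP (X A : Type*) [Fintype X] where
  trans : A → X → X → ℝ
  trans_nonneg : ∀ b y y', 0 ≤ trans b y y'
  trans_sum : ∀ b y, ∑ y', trans b y y' = 1
  reward : X → A → ℝ

/-- A (randomised, stationary) policy: `prob y b` is the probability of choosing action `b` in
state `y`. -/
structure FinitePolicy (X A : Type*) [Fintype A] where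
  prob : X → A → ℝ
  prob_nonneg : ∀ y b, 0 ≤ prob y b
  prob_sum : ∀ y, ∑ b, prob y b = 1

/-- The transition matrix of the state chain induced by a policy. -/
def stateMatrix {X A : Type*} [Fintype X] [Fintype A] (M : FiniteMDP X A)
    (p : FinitePolicy X A) : Matrix X X ℝ :=
  fun y y' => ∑ b, p.prob y b * M.trans b y y'

/-- Aperiodicity: for every state, the possible return times have greatest common divisor `1`. -/
def IsAperiodicMatrix {X : Type*} [Fintype X] [DecidableEq X] (P : Matrix X X ℝ) : Prop :=
  ∀ y, ∀ k : ℕ, (∀ n : ℕ, 1 ≤ n → 0 < (P ^ n) y y → k ∣ n) → k = 1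

/-- `μ` is a stationary (steady-state) probability vector of the transition matrix `P`. -/
structure IsStationaryDistribution {X : Type*} [Fintype X] (P : Matrix X X ℝ) (μ : X → ℝ) :
    Prop where
  nonneg : ∀ y, 0 ≤ μ y
  sum_eq_one : ∑ y, μ y = 1
  stationary : μ ᵥ* P = μ

/-- The states `x n` and actions `a n`, at the times `n ≥ m`, form a trajectory of the decision
process run under the policy: given the past and the current state, the action is drawn from the
policy; given the past and the current state and action, the next state is drawn from the
transition probabilities. The law of the first state `x m` is not prescribed. The time set `T`
will be `ℕ` or `ℤ`. -/
structure IsTrajectoryFrom {T Ω X A : Type*} [Preorder T] [Add T] [One T] [MeasurableSpace Ω]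
    [Fintype X] [MeasurableSpace X] [Fintype A] [MeasurableSpace A]
    (M : FiniteMDP X A) (p : FinitePolicy X A) (ℙ : Measure Ω)
    (x : T → Ω → X) (a : T → Ω → A) (m : T) : Prop where
  measurable_state : ∀ n, m ≤ n → Measurable (x n)
  measurable_action : ∀ n, m ≤ n → Measurable (a n)
  first_action : ∀ (y : X) (b : A),
    ℙ.real {ω | x m ω = y ∧ a m ω = b} = ℙ.real {ω | x m ω = y} * p.prob y b
  step : ∀ n, m ≤ n → ∀ (y : T → X) (b : T → A),
    ℙ.real {ω | ∀ i ∈ Set.Icc m (n + 1), x i ω = y i ∧ a i ω = b i} =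
      ℙ.real {ω | ∀ i ∈ Set.Icc m n, x i ω = y i ∧ a i ω = b i} *
        (M.trans (b n) (y n) (y (n + 1)) * p.prob (y (n + 1)) (b (n + 1)))

/-- `Q`, a measure on two-sided state-action paths, is the law of the two-sided stationary process
whose states have marginal law `μ`. Expectations `E_∞` in steady state are integrals against `Q`. -/
structure IsSteadyStateLaw {X A : Type*} [Fintype X] [MeasurableSpace X] [Fintype A]
    [MeasurableSpace A] (M : FiniteMDP X A) (p : FinitePolicy X A) (μ : X → ℝ)
    (Q : Measure (ℤ → X × A)) : Prop where
  trajectory : ∀ m : ℤ,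
    IsTrajectoryFrom M p Q (fun n path => (path n).1) (fun n path => (path n).2) m
  marginal : ∀ (n : ℤ) (y : X), Q.real {path | (path n).1 = y} = μ y

/-- The feature matrix `Φ`, whose row at the state `y` is `φ(y)ᵀ`. -/
def featureMatrix {X : Type*} {d : ℕ} (φ : X → EuclideanSpace ℝ (Fin d)) :
    Matrix X (Fin d) ℝ :=
  fun y j => φ y j

/-- The implicit TD(0) recursion along one realisation: a fixed-point equation for `w (n + 1)`. -/
def IsImplicitTDZero {X A : Type*} {d : ℕ} (γ : ℝ) (φ : X → EuclideanSpace ℝ (Fin d))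
    (r : X → A → ℝ) (α : ℕ → ℝ) (x : ℕ → X) (a : ℕ → A)
    (w : ℕ → EuclideanSpace ℝ (Fin d)) : Prop :=
  ∀ n, 1 ≤ n → w (n + 1) = w n +
    (α n * (r (x n) (a n) + γ * inner ℝ (φ (x (n + 1))) (w n)
      - inner ℝ (φ (x n)) (w (n + 1)))) • φ (x n)

/-- The eligibility trace: `e 0 = 0` and `e n = φ (x n) + (lam * γ) • e (n - 1)` for `n ≥ 1`. -/
def eligibilityTrace {X : Type*} {d : ℕ} (γ lam : ℝ) (φ : X → EuclideanSpace ℝ (Fin d))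
    (x : ℕ → X) : ℕ → EuclideanSpace ℝ (Fin d)
  | 0 => 0
  | n + 1 => φ (x (n + 1)) + (lam * γ) • eligibilityTrace γ lam φ x n

/-- The implicit TD(λ) recursion along one realisation: a fixed-point equation for `w (n + 1)`. -/
def IsImplicitTDLambda {X A : Type*} {d : ℕ} (γ lam : ℝ) (φ : X → EuclideanSpace ℝ (Fin d))
    (r : X → A → ℝ) (α : ℕ → ℝ) (x : ℕ → X) (a : ℕ → A)
    (w : ℕ → EuclideanSpace ℝ (Fin d)) : Prop :=
  ∀ n, 1 ≤ n → w (n + 1) = w n +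
    (α n * (r (x n) (a n) + γ * inner ℝ (φ (x (n + 1))) (w n)
      + lam * γ * inner ℝ (eligibilityTrace γ lam φ x (n - 1)) (w n)
      - inner ℝ (eligibilityTrace γ lam φ x n) (w (n + 1)))) • eligibilityTrace γ lam φ x n

/-- The steady-state eligibility trace `e_{-∞:0} = ∑_{k ≥ 0} (lam γ)^k φ_{-k}` of a path. -/
noncomputable def steadyTrace {X A : Type*} {d : ℕ} (γ lam : ℝ)
    (φ : X → EuclideanSpace ℝ (Fin d)) (path : ℤ → X × A) : EuclideanSpace ℝ (Fin d) :=
  ∑' k : ℕ, (lam * γ) ^ k • φ (path (-(k : ℤ))).1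

/-- `E_∞ (z φ_0ᵀ - γ z φ_1ᵀ)`, for a vector-valued function `z` of the path. -/
noncomputable def steadyMatrix {X A : Type*} {d : ℕ} [MeasurableSpace X] [MeasurableSpace A]
    (Q : Measure (ℤ → X × A)) (γ : ℝ) (φ : X → EuclideanSpace ℝ (Fin d))
    (z : (ℤ → X × A) → EuclideanSpace ℝ (Fin d)) : Matrix (Fin d) (Fin d) ℝ :=
  fun i j => ∫ path, (z path i * φ (path 0).1 j - γ * (z path i * φ (path 1).1 j)) ∂Q

/-- `E_∞ (r_0 z)`, for a vector-valued function `z` of the path. -/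
noncomputable def steadyVector {X A : Type*} {d : ℕ} [MeasurableSpace X] [MeasurableSpace A]
    (Q : Measure (ℤ → X × A)) (r : X → A → ℝ)
    (z : (ℤ → X × A) → EuclideanSpace ℝ (Fin d)) : Fin d → ℝ :=
  fun i => ∫ path, r (path 0).1 (path 0).2 * z path i ∂Q

/-- `v` solves the steady-state equation of TD(0): `E_∞ (φ_0 φ_0ᵀ - γ φ_0 φ_1ᵀ) v = E_∞ (r_0 φ_0)`. -/
def IsTDZeroSolution {X A : Type*} {d : ℕ} [MeasurableSpace X] [MeasurableSpace A]
    (Q : Measure (ℤ → X × A)) (γ : ℝ) (φ : X → EuclideanSpace ℝ (Fin d)) (r : X → A → ℝ)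
    (v : EuclideanSpace ℝ (Fin d)) : Prop :=
  steadyMatrix Q γ φ (fun path => φ (path 0).1) *ᵥ (fun j => v j) =
    steadyVector Q r (fun path => φ (path 0).1)

/-- `v` solves the steady-state equation of TD(λ):
`E_∞ (e_{-∞:0} φ_0ᵀ - γ e_{-∞:0} φ_1ᵀ) v = E_∞ (r_0 e_{-∞:0})`. -/
def IsTDLambdaSolution {X A : Type*} {d : ℕ} [MeasurableSpace X] [MeasurableSpace A]
    (Q : Measure (ℤ → X × A)) (γ lam : ℝ) (φ : X → EuclideanSpace ℝ (Fin d)) (r : X → A → ℝ)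
    (v : EuclideanSpace ℝ (Fin d)) : Prop :=
  steadyMatrix Q γ φ (steadyTrace γ lam φ) *ᵥ (fun j => v j) =
    steadyVector Q r (steadyTrace γ lam φ)

/-- Mean-square convergence `E ‖w_n - v‖² → 0`; the expectations are those of integrable
functions. -/
def ConvergesInMeanSquare {Ω : Type*} [MeasurableSpace Ω] {d : ℕ} (ℙ : Measure Ω)
    (w : ℕ → Ω → EuclideanSpace ℝ (Fin d)) (v : EuclideanSpace ℝ (Fin d)) : Prop :=
  (∀ n, 1 ≤ n → Integrable (fun ω => ‖w n ω - v‖ ^ 2) ℙ) ∧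
    Tendsto (fun n => ∫ ω, ‖w n ω - v‖ ^ 2 ∂ℙ) atTop (𝓝 0)

/-!
Solving the implicit equation for the new iterate turns implicit TD(λ) into the explicit recursion
`w (n + 1) = w n + a n • (δ n • e n)`, with temporal difference
`δ n = r n + γ ⟪φ (n + 1), w n⟫ - ⟪φ n, w n⟫` and random step size `a n = α n / (1 + α n ‖e n‖²)`
(`eq_add_smul_of_implicit`, `IsImplicitTDLambda.eq_explicit`). The traces are bounded, so
`0 ≤ α n - a n = O(α n ²)`, and the recursion is a linear stochastic approximation scheme with
bounded coefficients. TD(0) is the case `λ = 0`.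

The pairs (state, action) form a finite Markov chain with transition matrix `K`. Irreducibility and
aperiodicity make some power of the state matrix positive; Doeblin's argument then gives
`P ^ n → μ` (`tendsto_pow_apply_of_pow_pos`), and hence convergence of `K ^ n` to the stationary
law `ν`. The steady-state expectations are discounted sums of correlations,
`H(f, h) = ∑ κ ^ k * ∑ ν f (K ^ k h)` with `κ = λ γ` (`traceCorrelation`), so that the steady-state
matrix has entries `H(φ i, φ j - γ K φ j)`. With `a k = E [f (z 0) f (z k)]`, `|a k| ≤ a 0`,
summation by parts gives `H(f, f - γ K f) ≥ (1 - γ) a 0`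
(`le_traceCorrelation_sub_smul_mulVec`). Since `μ > 0` and `Φ` has full column rank, the matrix is
coercive; this gives the unique solution `wstar`.

For the convergence, let `u n = w n - wstar`. The iterate `u n` depends on the history up to time
`n` only, and the trace is a discounted sum whose remote past contributes little, so for a lag `τ`
large enough the drift at time `n + τ`, evaluated at the iterate `u n`, has the steady-state mean up
to `ε` (`IsMarkovChain.eventually_abs_integral_sub_le`). Its inner product with `u n` is therefore
at most `-β E‖u n‖² + ε (1 + E‖u n‖²)`, `β` being the coercivity constant. Over a fixed lag the
iterates move by a vanishing fraction of their size because `α n → 0`, so for every `ε` eventually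
`E‖u (n + 1)‖² ≤ (1 - β α n) E‖u n‖² + ε α n`, and `∑ α n = ∞` forces the limit to be `0`
(`tendsto_integral_norm_sq_of_lag`). Each `w n` takes finitely many values, being a function of a
finite history; this settles integrability.
-/

/-! ### Powers of stochastic matrices -/

lemma pow_add_apply_pos {Z : Type*} [Fintype Z] [DecidableEq Z] {P : Matrix Z Z ℝ}
    (hP : ∀ y z, 0 ≤ P y z) {m n : ℕ} {u v w : Z} (huv : 0 < (P ^ m) u v)
    (hvw : 0 < (P ^ n) v w) : 0 < (P ^ (m + n)) u w := by
  rw [pow_add, Matrix.mul_apply]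
  exact Finset.sum_pos' (fun y _ => mul_nonneg (Matrix.pow_apply_nonneg hP m u y)
    (Matrix.pow_apply_nonneg hP n y w)) ⟨v, Finset.mem_univ v, mul_pos huv hvw⟩

/-- Return times of a state are closed under addition, and an additive submonoid of `ℕ` with
greatest common divisor `1` contains every large number. -/
lemma IsAperiodicMatrix.eventually_pow_apply_self_pos {X : Type*} [Fintype X] [DecidableEq X]
    {P : Matrix X X ℝ} (hP : ∀ y z, 0 ≤ P y z) (hper : IsAperiodicMatrix P) (y : X) :
    ∀ᶠ n in atTop, 0 < (P ^ n) y y := by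
  let S : AddSubmonoid ℕ :=
    { carrier := {n | 0 < (P ^ n) y y}
      add_mem' := fun ha hb => pow_add_apply_pos hP ha hb
      zero_mem' := by simp }
  have hgcd : Nat.setGcd (S : Set ℕ) = 1 :=
    hper y _ fun n _ hn => Nat.setGcd_dvd_of_mem (s := (S : Set ℕ)) hn
  obtain ⟨N, hN⟩ := Nat.exists_mem_closure_of_ge (S : Set ℕ)
  filter_upwards [eventually_ge_atTop N] with n hn
  have := hN n hn (by simp [hgcd])
  rwa [AddSubmonoid.closure_eq] at this

lemma Matrix.IsIrreducible.exists_pow_pos_of_aperiodic {X : Type*} [Fintype X] [DecidableEq X]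
    {P : Matrix X X ℝ} (hirr : P.IsIrreducible) (hper : IsAperiodicMatrix P) :
    ∃ N : ℕ, ∀ y z, 0 < (P ^ N) y z := by
  have hk := (Matrix.isIrreducible_iff_exists_pow_pos hirr.nonneg).1 hirr
  have hpos : ∀ y z, ∀ᶠ n in atTop, 0 < (P ^ n) y z := by
    intro y z
    obtain ⟨k, -, hk⟩ := hk y z
    have h := hper.eventually_pow_apply_self_pos hirr.nonneg y
    filter_upwards [(tendsto_sub_atTop_nat k).eventually h, eventually_ge_atTop k] with n hn hkn
    have := pow_add_apply_pos hirr.nonneg hn hk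
    rwa [Nat.sub_add_cancel hkn] at this
  exact (eventually_all.2 fun y => eventually_all.2 fun z => hpos y z).exists

lemma abs_mulVec_le_of_mem_rowStochastic {Z : Type*} [Fintype Z] [DecidableEq Z]
    {P : Matrix Z Z ℝ} (hP : P ∈ Matrix.rowStochastic ℝ Z) {h : Z → ℝ} {C : ℝ}
    (hC : ∀ z, |h z| ≤ C) (z : Z) : |(P *ᵥ h) z| ≤ C := by
  calc |(P *ᵥ h) z| ≤ ∑ y, |P z y * h y| := Finset.abs_sum_le_sum_abs _ _
    _ ≤ ∑ y, P z y * C := Finset.sum_le_sum fun y _ => by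
        rw [abs_mul, abs_of_nonneg (hP.1 z y)]
        exact mul_le_mul_of_nonneg_left (hC y) (hP.1 z y)
    _ = C := by
        rw [← Finset.sum_mul, Matrix.sum_row_of_mem_rowStochastic hP, one_mul]

lemma vecMul_pow_eq {Z : Type*} [Fintype Z] [DecidableEq Z] {P : Matrix Z Z ℝ} {μ : Z → ℝ}
    (hμ : μ ᵥ* P = μ) (n : ℕ) : μ ᵥ* P ^ n = μ := by
  induction n with
  | zero => simp
  | succ n ih => rw [pow_succ, ← Matrix.vecMul_vecMul, ih, hμ]

/-- Doeblin's argument: `P ^ N` dominates `δ` times the matrix with all rows equal to `μ`, and so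
contracts the sup-norm of a function of `μ`-mean zero by the factor `1 - δ`. -/
theorem tendsto_pow_apply_of_pow_pos {X : Type*} [Fintype X] [DecidableEq X]
    {P : Matrix X X ℝ} (hP : P ∈ Matrix.rowStochastic ℝ X) {N : ℕ}
    (hN : ∀ y z, 0 < (P ^ N) y z) {μ : X → ℝ} (hμ : IsStationaryDistribution P μ) (y z : X) :
    Tendsto (fun n => (P ^ n) y z) atTop (𝓝 (μ z)) := by
  have hPn : ∀ n, P ^ n ∈ Matrix.rowStochastic ℝ X := fun n => pow_mem hP n
  have hμ1 : ∀ z, μ z ≤ 1 := fun z => by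
    rw [← hμ.sum_eq_one]
    exact Finset.single_le_sum (fun i _ => hμ.nonneg i) (Finset.mem_univ z)
  have : Nonempty X := ⟨y⟩
  obtain ⟨q, -, hq⟩ := Finset.exists_min_image (Finset.univ : Finset (X × X))
    (fun q => (P ^ N) q.1 q.2) Finset.univ_nonempty
  set δ := (P ^ N) q.1 q.2 with hδ
  have hδ0 : 0 < δ := hN _ _
  have hδ1 : δ ≤ 1 := Matrix.le_one_of_mem_rowStochastic (hPn N)
  have hdom : ∀ u v, 0 ≤ (P ^ N) u v - δ * μ v := fun u v => by
    have h1 := hq (u, v) (Finset.mem_univ _)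
    have h2 : δ * μ v ≤ δ * 1 := mul_le_mul_of_nonneg_left (hμ1 v) hδ0.le
    simp only at h1
    linarith
  have hcontr : ∀ (h : X → ℝ) (C : ℝ), μ ⬝ᵥ h = 0 → (∀ u, |h u| ≤ C) →
      ∀ u, |((P ^ N) *ᵥ h) u| ≤ (1 - δ) * C := by
    intro h C h0 hC u
    have e : ((P ^ N) *ᵥ h) u = ∑ v, ((P ^ N) u v - δ * μ v) * h v := by
      have : ∑ v, δ * μ v * h v = δ * (μ ⬝ᵥ h) := by
        simp [dotProduct, Finset.mul_sum, mul_assoc]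
      simp only [sub_mul, Finset.sum_sub_distrib, this, h0]
      simp [Matrix.mulVec, dotProduct]
    rw [e]
    calc _ ≤ ∑ v, |((P ^ N) u v - δ * μ v) * h v| := Finset.abs_sum_le_sum_abs _ _
      _ ≤ ∑ v, ((P ^ N) u v - δ * μ v) * C := Finset.sum_le_sum fun v _ => by
          rw [abs_mul, abs_of_nonneg (hdom u v)]
          exact mul_le_mul_of_nonneg_left (hC v) (hdom u v)
      _ = (1 - δ) * C := by
          rw [← Finset.sum_mul, Finset.sum_sub_distrib, ← Finset.mul_sum, hμ.sum_eq_one,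
            Matrix.sum_row_of_mem_rowStochastic (hPn N), mul_one]
  -- the centred indicator of `z`, whose image under `P ^ n` is `P ^ n · z - μ z`
  set h : X → ℝ := fun v => (if v = z then 1 else 0) - μ z with hh
  have hPh : ∀ n u, ((P ^ n) *ᵥ h) u = (P ^ n) u z - μ z := by
    intro n u
    simp only [hh, Matrix.mulVec, dotProduct, mul_sub, Finset.sum_sub_distrib, mul_ite, mul_one,
      mul_zero, Finset.sum_ite_eq', Finset.mem_univ, if_true]
    rw [← Finset.sum_mul, Matrix.sum_row_of_mem_rowStochastic (hPn n), one_mul]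
  have hmean : ∀ n, μ ⬝ᵥ ((P ^ n) *ᵥ h) = 0 := by
    intro n
    rw [Matrix.dotProduct_mulVec, vecMul_pow_eq hμ.stationary]
    simp only [hh, dotProduct, mul_sub, Finset.sum_sub_distrib, mul_ite, mul_one, mul_zero,
      Finset.sum_ite_eq', Finset.mem_univ, if_true]
    rw [← Finset.sum_mul, hμ.sum_eq_one, one_mul, sub_self]
  have hh1 : ∀ u, |h u| ≤ 1 := by
    intro u
    have h0 := hμ.nonneg z
    have h1 := hμ1 z
    simp only [hh]
    split_ifs <;> rw [abs_le] <;> constructor <;> linarith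
  have hblock : ∀ j u, |((P ^ (N * j)) *ᵥ h) u| ≤ (1 - δ) ^ j := by
    intro j
    induction j with
    | zero => simpa using hh1
    | succ j ih =>
      intro u
      have := hcontr _ _ (hmean (N * j)) ih u
      rwa [Matrix.mulVec_mulVec, ← pow_add, add_comm, ← Nat.mul_succ, ← pow_succ'] at this
  rw [Metric.tendsto_atTop]
  intro ε hε
  obtain ⟨j, hj⟩ := exists_pow_lt_of_lt_one hε (by linarith : 1 - δ < 1)
  refine ⟨N * j, fun n hn => ?_⟩
  rw [Real.dist_eq, ← hPh]
  refine lt_of_le_of_lt ?_ hj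
  have := abs_mulVec_le_of_mem_rowStochastic (hPn (n - N * j)) (hblock j) y
  rwa [Matrix.mulVec_mulVec, ← pow_add, Nat.sub_add_cancel hn] at this

lemma IsStationaryDistribution.pos {X : Type*} [Fintype X] [DecidableEq X] {P : Matrix X X ℝ}
    {μ : X → ℝ} (hμ : IsStationaryDistribution P μ) {N : ℕ} (hN : ∀ y z, 0 < (P ^ N) y z)
    (z : X) : 0 < μ z := by
  have h : ∃ y ∈ Finset.univ, 0 < μ y :=
    Finset.exists_lt_of_sum_lt (f := fun _ => (0 : ℝ)) (by simp [hμ.sum_eq_one])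
  obtain ⟨y, -, hy⟩ := h
  rw [← congrFun (vecMul_pow_eq hμ.stationary N) z]
  exact Finset.sum_pos' (fun u _ => mul_nonneg (hμ.nonneg u) (hN u z).le)
    ⟨y, Finset.mem_univ y, mul_pos hy (hN y z)⟩

/-! ### Stochastic approximation with a lag -/

lemma tendsto_zero_of_le_one_sub_mul_add {V α : ℕ → ℝ} {β : ℝ} (hβ : 0 < β) (hV : ∀ n, 0 ≤ V n)
    (hα : Tendsto α atTop (𝓝 0))
    (hsum : Tendsto (fun n => ∑ k ∈ Finset.range n, α k) atTop atTop)
    (hstep : ∀ ε > 0, ∀ᶠ n in atTop, V (n + 1) ≤ (1 - β * α n) * V n + ε * α n) :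
    Tendsto V atTop (𝓝 0) := by
  rw [Metric.tendsto_atTop]
  intro ε hε
  have hsmall : ∀ᶠ n in atTop, β * α n ≤ 1 := by
    have : Tendsto (fun n => β * α n) atTop (𝓝 (β * 0)) := hα.const_mul β
    rw [mul_zero] at this
    exact this.eventually_le_const one_pos
  obtain ⟨N, hN⟩ := eventually_atTop.1
    ((hstep (β * (ε / 2)) (by positivity)).and (hsmall.and (eventually_ge_atTop 1)))
  set W : ℕ → ℝ := fun n => max (V n - ε / 2) 0 with hW
  have hWstep : ∀ n, N ≤ n → W (n + 1) ≤ Real.exp (-(β * α n)) * W n := by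
    intro n hn
    obtain ⟨h1, h2, h3⟩ := hN n hn
    have h4 : V (n + 1) - ε / 2 ≤ (1 - β * α n) * (V n - ε / 2) := by linarith
    have h5 : (1 - β * α n) * (V n - ε / 2) ≤ (1 - β * α n) * W n :=
      mul_le_mul_of_nonneg_left (le_max_left _ _) (by linarith)
    have h6 : 1 - β * α n ≤ Real.exp (-(β * α n)) := by
      have := Real.add_one_le_exp (-(β * α n))
      linarith
    have h7 : 0 ≤ W n := le_max_right _ _
    exact max_le (by nlinarith) (by positivity)
  have hWle : ∀ n, N ≤ n → W n ≤ Real.exp (-(β * (∑ k ∈ Finset.range n, α k))) *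
      (Real.exp (β * ∑ k ∈ Finset.range N, α k) * W N) := by
    intro n hn
    induction n, hn using Nat.le_induction with
    | base => rw [← mul_assoc, ← Real.exp_add]; simp
    | succ n hn ih =>
      calc W (n + 1) ≤ Real.exp (-(β * α n)) * W n := hWstep n hn
        _ ≤ _ := mul_le_mul_of_nonneg_left ih (Real.exp_nonneg _)
        _ = _ := by
          rw [← mul_assoc, ← Real.exp_add, Finset.sum_range_succ]
          ring_nf
  have hlim : Tendsto (fun n => Real.exp (-(β * (∑ k ∈ Finset.range n, α k))) *
      (Real.exp (β * ∑ k ∈ Finset.range N, α k) * W N)) atTop (𝓝 0) := by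
    have h := (Real.tendsto_exp_neg_atTop_nhds_zero.comp (hsum.const_mul_atTop hβ)).mul_const
      (Real.exp (β * ∑ k ∈ Finset.range N, α k) * W N)
    rw [zero_mul] at h
    exact h
  obtain ⟨N', hN'⟩ := eventually_atTop.1 (hlim.eventually_lt_const (half_pos hε))
  refine ⟨max N N', fun n hn => ?_⟩
  rw [Real.dist_eq, sub_zero, abs_of_nonneg (hV n)]
  have h1 := hWle n (le_of_max_le_left hn)
  have h2 := hN' n (le_of_max_le_right hn)
  have h3 : V n - ε / 2 ≤ W n := le_max_left _ _
  linarith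

/-- Over a fixed number `τ` of steps, a recursion of linear growth moves by a small fraction of its
size once the step sizes are small. -/
lemma eventually_norm_sub_le_of_lag {Ω E : Type*} [NormedAddCommGroup E] {u : ℕ → Ω → E}
    {α : ℕ → ℝ} {C : ℝ} (hC : 0 ≤ C) (hα : Tendsto α atTop (𝓝 0)) (hα0 : ∀ n, 1 ≤ n → 0 ≤ α n)
    (hu : ∀ n, 1 ≤ n → ∀ ω, ‖u (n + 1) ω - u n ω‖ ≤ α n * (C * (1 + ‖u n ω‖))) (τ : ℕ) :
    ∀ δ > 0, ∀ᶠ m in atTop, ∀ ω, ‖u (m + τ) ω - u m ω‖ ≤ δ * (1 + ‖u m ω‖) := by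
  induction τ with
  | zero =>
    intro δ hδ
    refine Eventually.of_forall fun m ω => ?_
    simp only [add_zero, sub_self, norm_zero]
    positivity
  | succ τ ih =>
    intro δ hδ
    have hα' : ∀ᶠ m in atTop, α (m + τ) * C * 2 < δ / 2 := by
      have h := ((hα.comp (tendsto_add_atTop_nat τ)).mul_const C).mul_const 2
      rw [zero_mul, zero_mul] at h
      exact h.eventually_lt_const (half_pos hδ)
    filter_upwards [ih (min (δ / 2) 1) (by positivity), hα', eventually_ge_atTop 1]
      with m h1 h2 hm ω
    have h1 := h1 ω
    have h3 := hu (m + τ) (by omega) ω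
    have h4 : ‖u (m + τ + 1) ω - u m ω‖ ≤
        ‖u (m + τ + 1) ω - u (m + τ) ω‖ + ‖u (m + τ) ω - u m ω‖ :=
      norm_sub_le_norm_sub_add_norm_sub ..
    have h5 : ‖u (m + τ) ω‖ ≤ ‖u (m + τ) ω - u m ω‖ + ‖u m ω‖ := by
      simpa using norm_add_le (u (m + τ) ω - u m ω) (u m ω)
    have h6 : min (δ / 2) 1 * (1 + ‖u m ω‖) ≤ δ / 2 * (1 + ‖u m ω‖) :=
      mul_le_mul_of_nonneg_right (min_le_left _ _) (by positivity)
    have h7 : min (δ / 2) 1 * (1 + ‖u m ω‖) ≤ 1 * (1 + ‖u m ω‖) :=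
      mul_le_mul_of_nonneg_right (min_le_right _ _) (by positivity)
    have h8 : α (m + τ) * (C * (1 + ‖u (m + τ) ω‖)) ≤ α (m + τ) * (C * (2 * (1 + ‖u m ω‖))) := by
      have := hα0 (m + τ) (by omega)
      gcongr
      linarith
    have h9 : α (m + τ) * C * 2 * (1 + ‖u m ω‖) ≤ δ / 2 * (1 + ‖u m ω‖) :=
      mul_le_mul_of_nonneg_right h2.le (by positivity)
    rw [← add_assoc]
    linarith

/-- The one-step energy estimate. The drift at the current iterate `v` is replaced by the drift at
an earlier iterate `v'`, at distance at most `δ * (1 + ‖v'‖)`. -/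
lemma norm_sq_add_smul_le {E : Type*} [NormedAddCommGroup E] [InnerProductSpace ℝ E]
    {F : E → E} {C δ a α : ℝ} {v v' : E} (hC : 0 ≤ C) (hF0 : ‖F 0‖ ≤ C)
    (hF : ∀ x y, ‖F x - F y‖ ≤ C * ‖x - y‖) (hδ0 : 0 ≤ δ) (hδ : δ ≤ 1 / 2) (ha0 : 0 ≤ a)
    (ha : a ≤ α) (ha2 : α - a ≤ C * α ^ 2) (hv : ‖v - v'‖ ≤ δ * (1 + ‖v'‖)) :
    ‖v + a • F v‖ ^ 2 ≤ ‖v‖ ^ 2 + 2 * α * inner ℝ v' (F v') +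
        (24 * δ * C * α + 6 * C ^ 2 * α ^ 2) * (1 + ‖v‖ ^ 2) ∧
      ‖v‖ ^ 2 - 12 * δ * (1 + ‖v‖ ^ 2) ≤ ‖v'‖ ^ 2 ∧ 1 + ‖v'‖ ^ 2 ≤ 9 * (1 + ‖v‖ ^ 2) := by
  have hα : 0 ≤ α := ha0.trans ha
  set x := ‖v‖ with hx
  set y := ‖v'‖ with hy
  have hx0 : 0 ≤ x := norm_nonneg _
  have hy0 : 0 ≤ y := norm_nonneg _
  have hsq : (1 + x) ^ 2 ≤ 2 * (1 + x ^ 2) := by nlinarith [sq_nonneg (1 - x)]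
  have hyx : 1 + y ≤ 2 * (1 + x) := by
    have h1 : y ≤ x + ‖v - v'‖ := by
      have := norm_sub_norm_le v' v
      rw [norm_sub_rev] at this
      linarith
    nlinarith
  have hxy : x ≤ y + ‖v - v'‖ := by
    have := norm_sub_norm_le v v'
    linarith
  have hd : ‖v - v'‖ ≤ 2 * δ * (1 + x) := by nlinarith
  have hd0 := norm_nonneg (v - v')
  have hFv : ‖F v‖ ≤ C * (1 + x) := by
    have h1 := hF v 0
    have h2 : ‖F v‖ ≤ ‖F v - F 0‖ + ‖F 0‖ := by simpa using norm_add_le (F v - F 0) (F 0)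
    rw [sub_zero] at h1
    linarith
  have hinner : |inner ℝ v (F v)| ≤ C * (1 + x) ^ 2 := by
    calc |inner ℝ v (F v)| ≤ x * ‖F v‖ := abs_real_inner_le_norm _ _
      _ ≤ (1 + x) * (C * (1 + x)) := by gcongr; linarith
      _ = C * (1 + x) ^ 2 := by ring
  have hdrift : inner ℝ v (F v) ≤ inner ℝ v' (F v') + 12 * δ * C * (1 + x ^ 2) := by
    have e : inner ℝ v (F v) - inner ℝ v' (F v') =
        inner ℝ (v - v') (F v) + inner ℝ v' (F v - F v') := by
      rw [inner_sub_left, inner_sub_right]; ring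
    have h1 : inner ℝ (v - v') (F v) ≤ 2 * δ * (1 + x) * (C * (1 + x)) :=
      (real_inner_le_norm _ _).trans (by gcongr)
    have h2 : inner ℝ v' (F v - F v') ≤ 2 * (1 + x) * (C * (2 * δ * (1 + x))) := by
      refine (real_inner_le_norm _ _).trans ?_
      have := hF v v'
      have h3 : C * ‖v - v'‖ ≤ C * (2 * δ * (1 + x)) := by gcongr
      have h4 : y ≤ 2 * (1 + x) := by linarith
      exact mul_le_mul h4 (this.trans h3) (norm_nonneg _) (by positivity)
    have h3 : δ * C * (1 + x) ^ 2 ≤ δ * C * (2 * (1 + x ^ 2)) := by gcongr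
    nlinarith
  refine ⟨?_, ?_, ?_⟩
  · have e : ‖v + a • F v‖ ^ 2 = x ^ 2 + 2 * (a * inner ℝ v (F v)) + a ^ 2 * ‖F v‖ ^ 2 := by
      rw [norm_add_sq_real, inner_smul_right, norm_smul, mul_pow, Real.norm_eq_abs, sq_abs]
    have h1 : a * inner ℝ v (F v) ≤ α * inner ℝ v (F v) + C * α ^ 2 * (C * (1 + x) ^ 2) := by
      have h2 : (α - a) * -inner ℝ v (F v) ≤ (C * α ^ 2) * (C * (1 + x) ^ 2) := by
        calc (α - a) * -inner ℝ v (F v) ≤ (α - a) * (C * (1 + x) ^ 2) := by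
              refine mul_le_mul_of_nonneg_left ?_ (by linarith)
              exact (neg_le_abs _).trans hinner
          _ ≤ _ := mul_le_mul_of_nonneg_right ha2 (by positivity)
      linarith
    have h2 : a ^ 2 * ‖F v‖ ^ 2 ≤ α ^ 2 * (C * (1 + x)) ^ 2 := by gcongr
    have h3 : α * inner ℝ v (F v) ≤ α * (inner ℝ v' (F v') + 12 * δ * C * (1 + x ^ 2)) :=
      mul_le_mul_of_nonneg_left hdrift hα
    have h4 : C ^ 2 * α ^ 2 * (1 + x) ^ 2 ≤ C ^ 2 * α ^ 2 * (2 * (1 + x ^ 2)) := by gcongr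
    rw [e]
    nlinarith
  · have h1 : x ^ 2 - y ^ 2 ≤ 2 * δ * (1 + x) * (3 * (1 + x)) := by
      calc x ^ 2 - y ^ 2 = (x - y) * (x + y) := by ring
        _ ≤ 2 * δ * (1 + x) * (x + y) := mul_le_mul_of_nonneg_right (by linarith) (by positivity)
        _ ≤ _ := mul_le_mul_of_nonneg_left (by linarith) (by positivity)
    have h2 : δ * (1 + x) ^ 2 ≤ δ * (2 * (1 + x ^ 2)) := by gcongr
    nlinarith
  · have : y ^ 2 ≤ (2 * (1 + x)) ^ 2 := by
      gcongr
      linarith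
    nlinarith

/-- Mean-square convergence of a stochastic approximation scheme whose drift is dissipative only on
average and only when it is observed with a delay `τ`. -/
theorem tendsto_integral_norm_sq_of_lag {Ω E : Type*} [MeasurableSpace Ω] {ℙ : Measure Ω}
    [IsProbabilityMeasure ℙ] [NormedAddCommGroup E] [InnerProductSpace ℝ E] {u : ℕ → Ω → E}
    {F : ℕ → Ω → E → E} {a : ℕ → Ω → ℝ} {α : ℕ → ℝ} {β C : ℝ} (hβ : 0 < β) (hC : 0 ≤ C)
    (hα : Tendsto α atTop (𝓝 0)) (hα0 : ∀ n, 1 ≤ n → 0 ≤ α n)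
    (hsum : Tendsto (fun n => ∑ k ∈ Finset.range n, α k) atTop atTop)
    (ha0 : ∀ n, 1 ≤ n → ∀ ω, 0 ≤ a n ω) (ha : ∀ n, 1 ≤ n → ∀ ω, a n ω ≤ α n)
    (ha2 : ∀ n, 1 ≤ n → ∀ ω, α n - a n ω ≤ C * α n ^ 2)
    (hF0 : ∀ n, 1 ≤ n → ∀ ω, ‖F n ω 0‖ ≤ C)
    (hF : ∀ n, 1 ≤ n → ∀ ω v v', ‖F n ω v - F n ω v'‖ ≤ C * ‖v - v'‖)
    (hu : ∀ n, 1 ≤ n → ∀ ω, u (n + 1) ω = u n ω + a n ω • F n ω (u n ω))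
    (hint : ∀ n, 1 ≤ n → Integrable (fun ω => ‖u n ω‖ ^ 2) ℙ)
    (hintF : ∀ m n, 1 ≤ m → m ≤ n → Integrable (fun ω => inner ℝ (u m ω) (F n ω (u m ω))) ℙ)
    (hlag : ∀ ε > 0, ∃ τ, ∀ n, 1 ≤ n → ∫ ω, inner ℝ (u n ω) (F (n + τ) ω (u n ω)) ∂ℙ ≤
      -β * ∫ ω, ‖u n ω‖ ^ 2 ∂ℙ + ε * (1 + ∫ ω, ‖u n ω‖ ^ 2 ∂ℙ)) :
    Tendsto (fun n => ∫ ω, ‖u n ω‖ ^ 2 ∂ℙ) atTop (𝓝 0) := by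
  set V : ℕ → ℝ := fun n => ∫ ω, ‖u n ω‖ ^ 2 ∂ℙ with hVdef
  have hV0 : ∀ n, 0 ≤ V n := fun n => integral_nonneg fun ω => by positivity
  refine tendsto_zero_of_le_one_sub_mul_add hβ hV0 hα hsum fun ε hε => ?_
  have hincr : ∀ n, 1 ≤ n → ∀ ω, ‖u (n + 1) ω - u n ω‖ ≤ α n * (C * (1 + ‖u n ω‖)) := by
    intro n hn ω
    rw [hu n hn ω, add_sub_cancel_left, norm_smul, Real.norm_eq_abs, abs_of_nonneg (ha0 n hn ω)]
    have h1 := hF n hn ω (u n ω) 0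
    have h2 : ‖F n ω (u n ω)‖ ≤ ‖F n ω (u n ω) - F n ω 0‖ + ‖F n ω 0‖ := by
      simpa using norm_add_le (F n ω (u n ω) - F n ω 0) (F n ω 0)
    have h3 := hF0 n hn ω
    rw [sub_zero] at h1
    exact mul_le_mul (ha n hn ω) (by linarith) (norm_nonneg _) (hα0 n hn)
  -- `η` bounds the total error per unit step: at most `η / 4` each from the noise of the lagged
  -- drift, from the displacement over the lag, and from the second-order term
  set η := min ε β with hη
  have hη0 : 0 < η := lt_min hε hβ
  obtain ⟨τ, hτ⟩ := hlag (η / 72) (by positivity)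
  set δ := min (1 / 2) (η / (96 * (β + C))) with hδ
  have hδ0 : 0 < δ := by positivity
  have hδη : 24 * (β + C) * δ ≤ η / 4 := by
    have h1 : δ ≤ η / (96 * (β + C)) := min_le_right _ _
    rw [le_div_iff₀ (by positivity)] at h1
    linarith
  have hαη : ∀ᶠ m in atTop, 6 * C ^ 2 * α (m + τ) < η / 4 := by
    have h := (hα.comp (tendsto_add_atTop_nat τ)).const_mul (6 * C ^ 2)
    rw [mul_zero] at h
    exact h.eventually_lt_const (by positivity)
  have hev := (eventually_norm_sub_le_of_lag hC hα hα0 hincr τ δ hδ0).and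
    (hαη.and (eventually_ge_atTop 1))
  filter_upwards [(tendsto_sub_atTop_nat τ).eventually hev, eventually_ge_atTop τ] with n hn hτn
  obtain ⟨hclose, hαn, hm⟩ := hn
  obtain ⟨m, rfl⟩ : ∃ m, n = m + τ := ⟨n - τ, by omega⟩
  rw [Nat.add_sub_cancel] at hclose hαn hm
  have hn1 : 1 ≤ m + τ := by omega
  have hpt := fun ω => norm_sq_add_smul_le hC (hF0 _ hn1 ω) (hF _ hn1 ω) hδ0.le (min_le_left _ _)
    (ha0 _ hn1 ω) (ha _ hn1 ω) (ha2 _ hn1 ω) (hclose ω)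
  have hIn := hint _ hn1
  have hIm := hint m hm
  have hI1 : Integrable (fun ω => 1 + ‖u (m + τ) ω‖ ^ 2) ℙ := (integrable_const 1).add hIn
  have hV1 : ∫ ω, (1 + ‖u (m + τ) ω‖ ^ 2) ∂ℙ = 1 + V (m + τ) := by
    rw [integral_add (integrable_const 1) hIn]; simp [hVdef]
  have hstep : V (m + τ + 1) ≤ V (m + τ) +
      2 * α (m + τ) * (∫ ω, inner ℝ (u m ω) (F (m + τ) ω (u m ω)) ∂ℙ) +
      (24 * δ * C * α (m + τ) + 6 * C ^ 2 * α (m + τ) ^ 2) * (1 + V (m + τ)) := by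
    have hIF := hintF m (m + τ) hm (by omega)
    have hI2 : Integrable (fun ω => ‖u (m + τ) ω‖ ^ 2 +
        2 * α (m + τ) * inner ℝ (u m ω) (F (m + τ) ω (u m ω))) ℙ := hIn.add (hIF.const_mul _)
    rw [← hV1, ← integral_const_mul, ← integral_const_mul, hVdef]
    simp only
    rw [← integral_add hIn (hIF.const_mul _), ← integral_add hI2 (hI1.const_mul _)]
    refine integral_mono (hint _ (by omega)) (hI2.add (hI1.const_mul _)) fun ω => ?_
    simp only [hu _ hn1 ω]
    exact (hpt ω).1
  have hlow : V (m + τ) - 12 * δ * (1 + V (m + τ)) ≤ V m := by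
    rw [← hV1, ← integral_const_mul, hVdef]
    simp only
    rw [← integral_sub hIn (hI1.const_mul _)]
    exact integral_mono (hIn.sub (hI1.const_mul _)) hIm fun ω => (hpt ω).2.1
  have hupp : 1 + V m ≤ 9 * (1 + V (m + τ)) := by
    rw [← hV1, ← integral_const_mul]
    have : ∫ ω, (1 + ‖u m ω‖ ^ 2) ∂ℙ = 1 + V m := by
      rw [integral_add (integrable_const 1) hIm]; simp [hVdef]
    rw [← this]
    exact integral_mono ((integrable_const 1).add hIm) (hI1.const_mul _) fun ω => (hpt ω).2.2
  have hτm := hτ m hm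
  change _ ≤ -β * V m + η / 72 * (1 + V m) at hτm
  have hα1 := hα0 _ hn1
  have hVn := hV0 (m + τ)
  set v := V (m + τ)
  set t := α (m + τ)
  have h1 : ∫ ω, inner ℝ (u m ω) (F (m + τ) ω (u m ω)) ∂ℙ ≤
      -β * v + (12 * β * δ + η / 8) * (1 + v) := by
    have h2 := mul_le_mul_of_nonneg_left hlow hβ.le
    have h3 := mul_le_mul_of_nonneg_left hupp (by positivity : 0 ≤ η / 72)
    linarith
  have h2 := mul_le_mul_of_nonneg_left h1 (by positivity : 0 ≤ 2 * t)
  have h3 : 2 * t * ((12 * β * δ + η / 8) * (1 + v)) +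
      (24 * δ * C * t + 6 * C ^ 2 * t ^ 2) * (1 + v) ≤ η * t * (1 + v) := by
    have h4 : 24 * (β + C) * δ + η / 4 + 6 * C ^ 2 * t ≤ η := by linarith
    have h5 := mul_le_mul_of_nonneg_right h4 (by positivity : 0 ≤ t * (1 + v))
    linarith
  have h4 : η * t ≤ ε * t := mul_le_mul_of_nonneg_right (min_le_left _ _) hα1
  have h5 : η * (t * v) ≤ β * (t * v) :=
    mul_le_mul_of_nonneg_right (min_le_right _ _) (by positivity)
  linarith

/-! ### Finite Markov chains and their histories -/

/-- The path of a process `z` over the times `1, …, n`. A random quantity that depends on this path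
only is one that satisfies `Function.FactorsThrough · (history z n)`. -/
def history {Ω Z : Type*} (z : ℕ → Ω → Z) (n : ℕ) (ω : Ω) : Finset.Icc 1 n → Z := fun i => z i ω

/-- Under `ℙ`, the process `z 1, z 2, …` is a Markov chain with transition matrix `K`; the law of
`z 1` is arbitrary. -/
structure IsMarkovChain {Ω Z : Type*} [MeasurableSpace Ω] [MeasurableSpace Z] (K : Matrix Z Z ℝ)
    (ℙ : Measure Ω) (z : ℕ → Ω → Z) : Prop where
  measurable : ∀ n, 1 ≤ n → Measurable (z n)
  step : ∀ n, 1 ≤ n → ∀ y : ℕ → Z,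
    ℙ.real {ω | ∀ i ∈ Set.Icc 1 (n + 1), z i ω = y i} =
      ℙ.real {ω | ∀ i ∈ Set.Icc 1 n, z i ω = y i} * K (y n) (y (n + 1))

lemma IsMarkovChain.measurable_history {Ω Z : Type*} [MeasurableSpace Ω] [MeasurableSpace Z]
    {K : Matrix Z Z ℝ} {ℙ : Measure Ω} {z : ℕ → Ω → Z} (hz : IsMarkovChain K ℙ z) (n : ℕ) :
    Measurable (history z n) :=
  measurable_pi_lambda _ fun i => hz.measurable i (Finset.mem_Icc.1 i.2).1

section History

variable {Ω Z β : Type*} {z : ℕ → Ω → Z} {m n : ℕ}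

lemma factorsThrough_history_mono {G : Ω → β} (hmn : m ≤ n) (hG : G.FactorsThrough (history z m)) :
    G.FactorsThrough (history z n) := fun _ _ h => hG <| funext fun i =>
  congrFun h ⟨i, Finset.mem_Icc.2 ⟨(Finset.mem_Icc.1 i.2).1, (Finset.mem_Icc.1 i.2).2.trans hmn⟩⟩

lemma factorsThrough_history_self {i : ℕ} (hi : 1 ≤ i) (hin : i ≤ n) (h : Z → β) :
    (fun ω => h (z i ω)).FactorsThrough (history z n) := fun _ _ e =>
  congrArg h (congrFun e ⟨i, Finset.mem_Icc.2 ⟨hi, hin⟩⟩)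

lemma factorsThrough_map₂ {β' δ H : Type*} {p : Ω → H} {G : Ω → β} {G' : Ω → β'}
    (op : β → β' → δ) (hG : G.FactorsThrough p) (hG' : G'.FactorsThrough p) :
    (fun ω => op (G ω) (G' ω)).FactorsThrough p := fun _ _ e => congrArg₂ op (hG e) (hG' e)

end History

namespace IsMarkovChain

variable {Ω Z : Type*} [MeasurableSpace Ω] [Fintype Z] [MeasurableSpace Z]
  [MeasurableSingletonClass Z] {K : Matrix Z Z ℝ} {ℙ : Measure Ω} [IsProbabilityMeasure ℙ]
  {z : ℕ → Ω → Z}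

lemma integrable (hz : IsMarkovChain K ℙ z) {n : ℕ} {G : Ω → ℝ}
    (hG : G.FactorsThrough (history z n)) : Integrable G ℙ := by
  obtain ⟨g, rfl⟩ := (Function.factorsThrough_iff G).1 hG
  have := Measure.isProbabilityMeasure_map (μ := ℙ) (hz.measurable_history n).aemeasurable
  exact (Integrable.of_finite (μ := ℙ.map (history z n)) (f := g)).comp_measurable
    (hz.measurable_history n)

lemma integral_mul_apply_succ (hz : IsMarkovChain K ℙ z) {n : ℕ} (hn : 1 ≤ n) {G : Ω → ℝ}
    (hG : G.FactorsThrough (history z n)) (h : Z → ℝ) :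
    ∫ ω, G ω * h (z (n + 1) ω) ∂ℙ = ∫ ω, G ω * (K *ᵥ h) (z n ω) ∂ℙ := by
  classical
  obtain ⟨g, rfl⟩ := (Function.factorsThrough_iff G).1 hG
  have hH := hz.measurable_history n
  have hT : Measurable fun ω => (history z n ω, z (n + 1) ω) :=
    hH.prodMk (hz.measurable _ (by omega))
  have := Measure.isProbabilityMeasure_map (μ := ℙ) hH.aemeasurable
  have := Measure.isProbabilityMeasure_map (μ := ℙ) hT.aemeasurable
  have hl : ∫ ω, (g ∘ history z n) ω * h (z (n + 1) ω) ∂ℙ =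
      ∑ q : (Finset.Icc 1 n → Z) × Z,
        ℙ.real {ω | (history z n ω, z (n + 1) ω) = q} * (g q.1 * h q.2) := by
    have e := integral_map (μ := ℙ) hT.aemeasurable
      (f := fun q : (Finset.Icc 1 n → Z) × Z => g q.1 * h q.2)
      (Integrable.of_finite).aestronglyMeasurable
    simp only [Function.comp_apply]
    rw [← e, integral_fintype Integrable.of_finite]
    refine Finset.sum_congr rfl fun q _ => ?_
    rw [map_measureReal_apply hT (measurableSet_singleton q), smul_eq_mul]
    rfl
  have hr : ∫ ω, (g ∘ history z n) ω * (K *ᵥ h) (z n ω) ∂ℙ =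
      ∑ q : Finset.Icc 1 n → Z, ℙ.real {ω | history z n ω = q} *
        (g q * (K *ᵥ h) (q ⟨n, Finset.mem_Icc.2 ⟨hn, le_rfl⟩⟩)) := by
    have e := integral_map (μ := ℙ) hH.aemeasurable
      (f := fun q : Finset.Icc 1 n → Z =>
        g q * (K *ᵥ h) (q ⟨n, Finset.mem_Icc.2 ⟨hn, le_rfl⟩⟩))
      (Integrable.of_finite).aestronglyMeasurable
    simp only [Function.comp_apply]
    rw [show (fun ω => g (history z n ω) * (K *ᵥ h) (z n ω)) = fun ω => g (history z n ω) *
      (K *ᵥ h) (history z n ω ⟨n, Finset.mem_Icc.2 ⟨hn, le_rfl⟩⟩) from rfl, ← e,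
      integral_fintype Integrable.of_finite]
    refine Finset.sum_congr rfl fun q _ => ?_
    rw [map_measureReal_apply hH (measurableSet_singleton q), smul_eq_mul]
    rfl
  have hstep : ∀ (q : Finset.Icc 1 n → Z) (v : Z),
      ℙ.real {ω | (history z n ω, z (n + 1) ω) = (q, v)} =
        ℙ.real {ω | history z n ω = q} * K (q ⟨n, Finset.mem_Icc.2 ⟨hn, le_rfl⟩⟩) v := by
    intro q v
    let y : ℕ → Z := fun i => if hi : i ∈ Finset.Icc 1 n then q ⟨i, hi⟩ else v
    have hy : ∀ i (hi : i ∈ Finset.Icc 1 n), y i = q ⟨i, hi⟩ := fun i hi => dif_pos hi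
    have hyn : y (n + 1) = v := dif_neg (by simp)
    have h1 : ∀ ω, (∀ i ∈ Set.Icc 1 n, z i ω = y i) ↔ history z n ω = q := by
      intro ω
      refine ⟨fun H => funext fun i => ?_, fun H i hi => ?_⟩
      · rw [← hy i i.2]
        exact H i (Finset.mem_Icc.1 i.2)
      · rw [hy i (Finset.mem_Icc.2 hi), ← H]
        rfl
    have h2 : ∀ ω, (∀ i ∈ Set.Icc 1 (n + 1), z i ω = y i) ↔
        (history z n ω, z (n + 1) ω) = (q, v) := by
      intro ω
      rw [Prod.mk.injEq, ← h1, ← hyn]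
      refine ⟨fun H => ⟨fun i hi => H i ⟨hi.1, hi.2.trans (by omega)⟩, H _ ⟨by omega, le_rfl⟩⟩,
        fun H i hi => ?_⟩
      rcases Nat.lt_or_ge n i with hlt | hle
      · have : i = n + 1 := le_antisymm hi.2 hlt
        rw [this]
        exact H.2
      · exact H.1 i ⟨hi.1, hle⟩
    have := hz.step n hn y
    simp only [h1, h2, hyn, hy n (Finset.mem_Icc.2 ⟨hn, le_rfl⟩)] at this
    exact this
  rw [hl, hr, Fintype.sum_prod_type]
  refine Finset.sum_congr rfl fun q _ => ?_
  simp only [hstep, Matrix.mulVec, dotProduct, Finset.mul_sum]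
  exact Finset.sum_congr rfl fun v _ => by ring

/-- The Markov property: given the history up to time `n`, the mean of `h (z (n + τ))` is
`K ^ τ *ᵥ h` at `z n`. -/
theorem integral_mul_apply_add [DecidableEq Z] (hz : IsMarkovChain K ℙ z) {n : ℕ} (hn : 1 ≤ n)
    {G : Ω → ℝ} (hG : G.FactorsThrough (history z n)) (h : Z → ℝ) (τ : ℕ) :
    ∫ ω, G ω * h (z (n + τ) ω) ∂ℙ = ∫ ω, G ω * ((K ^ τ) *ᵥ h) (z n ω) ∂ℙ := by
  induction τ generalizing h with
  | zero => simp
  | succ τ ih =>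
    rw [← add_assoc, hz.integral_mul_apply_succ (by omega)
      (factorsThrough_history_mono (Nat.le_add_right n τ) hG), ih, Matrix.mulVec_mulVec, pow_succ]

end IsMarkovChain

/-! ### Mixing of discounted traces -/

/-- The discounted trace `∑_{k < n} κ ^ k * f (z (n - k))` of a real function `f` along `z`, as a
recursion. -/
def discountedTrace {Z : Type*} (κ : ℝ) (f : Z → ℝ) (z : ℕ → Z) : ℕ → ℝ
  | 0 => 0
  | n + 1 => f (z (n + 1)) + κ * discountedTrace κ f z n

/-- The stationary correlation `∑_{k ≥ 0} κ ^ k E [f (z 0) * h (z k)]` of the discounted trace of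
`f` with `h`, for the chain with transition matrix `K` started from `ν`. -/
noncomputable def traceCorrelation {Z : Type*} [Fintype Z] [DecidableEq Z] (K : Matrix Z Z ℝ)
    (ν : Z → ℝ) (κ : ℝ) (f h : Z → ℝ) : ℝ :=
  ∑' k : ℕ, κ ^ k * ∑ y, ν y * (f y * ((K ^ k) *ᵥ h) y)

lemma exists_forall_abs_le {Z : Type*} [Finite Z] (f : Z → ℝ) : ∃ C, 0 ≤ C ∧ ∀ y, |f y| ≤ C := by
  obtain ⟨C, hC⟩ := (Set.finite_range fun y => |f y|).bddAbove
  exact ⟨max C 0, le_max_right _ _, fun y => (hC ⟨y, rfl⟩).trans (le_max_left _ _)⟩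

lemma abs_discountedTrace_le {Z : Type*} {κ : ℝ} (hκ0 : 0 ≤ κ) (hκ1 : κ < 1) {f : Z → ℝ} {C : ℝ}
    (hC0 : 0 ≤ C) (hC : ∀ y, |f y| ≤ C) (z : ℕ → Z) (n : ℕ) :
    |discountedTrace κ f z n| ≤ C / (1 - κ) := by
  have h1 : 0 < 1 - κ := by linarith
  induction n with
  | zero => simpa [discountedTrace] using div_nonneg hC0 h1.le
  | succ n ih =>
    have h2 : |f (z (n + 1)) + κ * discountedTrace κ f z n| ≤ C + κ * (C / (1 - κ)) := by
      refine (abs_add_le _ _).trans (add_le_add (hC _) ?_)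
      rw [abs_mul, abs_of_nonneg hκ0]
      exact mul_le_mul_of_nonneg_left ih hκ0
    refine h2.trans (le_of_eq ?_)
    field_simp
    ring

lemma factorsThrough_discountedTrace {Ω Z : Type*} (κ : ℝ) (f : Z → ℝ) (z : ℕ → Ω → Z) (n : ℕ) :
    (fun ω => discountedTrace κ f (fun i => z i ω) n).FactorsThrough (history z n) := by
  induction n with
  | zero => intro _ _ _; rfl
  | succ n ih =>
    intro ω ω' h
    exact factorsThrough_map₂ (fun p q : ℝ => p + κ * q)
      (factorsThrough_history_self (Nat.le_add_left 1 n) le_rfl f)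
      (factorsThrough_history_mono (Nat.le_succ n) ih) h

section Correlation

variable {Z : Type*} [Fintype Z] [DecidableEq Z] {K : Matrix Z Z ℝ} {ν : Z → ℝ} {κ : ℝ}

lemma abs_pow_mulVec_le (hK : K ∈ Matrix.rowStochastic ℝ Z) {h : Z → ℝ} {C : ℝ}
    (hC : ∀ y, |h y| ≤ C) (k : ℕ) (y : Z) : |((K ^ k) *ᵥ h) y| ≤ C :=
  abs_mulVec_le_of_mem_rowStochastic (pow_mem hK k) hC y

lemma summable_traceCorrelation (hK : K ∈ Matrix.rowStochastic ℝ Z) (hκ0 : 0 ≤ κ) (hκ1 : κ < 1)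
    (ν f h : Z → ℝ) :
    Summable fun k : ℕ => κ ^ k * ∑ y, ν y * (f y * ((K ^ k) *ᵥ h) y) := by
  obtain ⟨C, -, hC⟩ := exists_forall_abs_le h
  refine Summable.of_norm_bounded
    ((summable_geometric_of_lt_one hκ0 hκ1).mul_right (∑ y, |ν y| * (|f y| * C))) fun k => ?_
  rw [Real.norm_eq_abs, abs_mul, abs_of_nonneg (pow_nonneg hκ0 k)]
  refine mul_le_mul_of_nonneg_left ((Finset.abs_sum_le_sum_abs _ _).trans ?_) (pow_nonneg hκ0 k)
  refine Finset.sum_le_sum fun y _ => ?_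
  rw [abs_mul, abs_mul]
  gcongr
  exact abs_pow_mulVec_le hK hC k y

/-- The conditional mean of the truncated trace correlation, given the state `τ` steps earlier,
forgets that state as `τ` grows. -/
lemma tendsto_sum_pow_mulVec_traceCorrelation (hK : K ∈ Matrix.rowStochastic ℝ Z)
    (hlim : ∀ y y', Tendsto (fun n => (K ^ n) y y') atTop (𝓝 (ν y')))
    (hκ0 : 0 ≤ κ) (hκ1 : κ < 1) (f h : Z → ℝ) (y : Z) :
    Tendsto (fun τ => ∑ k ∈ Finset.range τ, κ ^ k * ((K ^ (τ - k)) *ᵥ (f * ((K ^ k) *ᵥ h))) y)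
      atTop (𝓝 (traceCorrelation K ν κ f h)) := by
  obtain ⟨C, hC0, hC⟩ := exists_forall_abs_le h
  obtain ⟨B, hB0, hB⟩ := exists_forall_abs_le f
  let a : ℕ → ℕ → ℝ := fun τ k =>
    if k < τ then κ ^ k * ((K ^ (τ - k)) *ᵥ (f * ((K ^ k) *ᵥ h))) y else 0
  have ha : ∀ τ, ∑' k, a τ k =
      ∑ k ∈ Finset.range τ, κ ^ k * ((K ^ (τ - k)) *ᵥ (f * ((K ^ k) *ᵥ h))) y := by
    intro τ
    rw [tsum_eq_sum (s := Finset.range τ) fun k hk => if_neg (by simpa using hk)]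
    exact Finset.sum_congr rfl fun k hk => if_pos (Finset.mem_range.1 hk)
  simp only [← ha]
  refine tendsto_tsum_of_dominated_convergence (bound := fun k => κ ^ k * (B * C))
    ((summable_geometric_of_lt_one hκ0 hκ1).mul_right _) (fun k => ?_)
    (Eventually.of_forall fun τ k => ?_)
  · have h1 : Tendsto (fun τ => κ ^ k * ((K ^ (τ - k)) *ᵥ (f * ((K ^ k) *ᵥ h))) y) atTop
        (𝓝 (κ ^ k * ∑ y', ν y' * (f y' * ((K ^ k) *ᵥ h) y'))) := by
      refine Tendsto.const_mul _ (tendsto_finsetSum _ fun y' _ => ?_)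
      exact ((hlim y y').comp (tendsto_sub_atTop_nat k)).mul_const _
    refine h1.congr' ?_
    filter_upwards [eventually_gt_atTop k] with τ hτ
    exact (if_pos hτ).symm
  · simp only [a]
    split_ifs
    · rw [Real.norm_eq_abs, abs_mul, abs_of_nonneg (pow_nonneg hκ0 k)]
      refine mul_le_mul_of_nonneg_left (abs_pow_mulVec_le hK (fun u => ?_) _ y) (pow_nonneg hκ0 k)
      rw [Pi.mul_apply, abs_mul]
      exact mul_le_mul (hB u) (abs_pow_mulVec_le hK hC k u) (abs_nonneg _) hB0
    · rw [norm_zero]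
      positivity

end Correlation

namespace IsMarkovChain

variable {Ω Z : Type*} [MeasurableSpace Ω] [Fintype Z] [DecidableEq Z] [MeasurableSpace Z]
  [MeasurableSingletonClass Z] {K : Matrix Z Z ℝ} {ℙ : Measure Ω} [IsProbabilityMeasure ℙ]
  {z : ℕ → Ω → Z} {ν : Z → ℝ} {κ : ℝ}

lemma integral_mul_discountedTrace (hz : IsMarkovChain K ℙ z) {n : ℕ} (hn : 1 ≤ n)
    {G : Ω → ℝ} (hG : G.FactorsThrough (history z n)) (κ : ℝ) (f h : Z → ℝ) (τ : ℕ) :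
    ∫ ω, G ω * (discountedTrace κ f (fun i => z i ω) (n + τ) * h (z (n + τ) ω)) ∂ℙ =
      ∫ ω, G ω * (∑ k ∈ Finset.range τ,
        κ ^ k * ((K ^ (τ - k)) *ᵥ (f * ((K ^ k) *ᵥ h))) (z n ω)) ∂ℙ +
      κ ^ τ * ∫ ω, G ω * (discountedTrace κ f (fun i => z i ω) n * ((K ^ τ) *ᵥ h) (z n ω)) ∂ℙ := by
  induction τ generalizing h with
  | zero => simp
  | succ τ ih =>
    have hGτ := factorsThrough_history_mono (Nat.le_add_right n τ) hG
    have hGD : (fun ω => G ω * discountedTrace κ f (fun i => z i ω) (n + τ)).FactorsThrough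
        (history z (n + τ)) :=
      factorsThrough_map₂ (· * ·) hGτ (factorsThrough_discountedTrace κ f z (n + τ))
    have hI1 : Integrable (fun ω => G ω * (f * h) (z (n + (τ + 1)) ω)) ℙ :=
      hz.integrable (n := n + (τ + 1)) (factorsThrough_map₂ (· * ·)
        (factorsThrough_history_mono (Nat.le_add_right n (τ + 1)) hG)
        (factorsThrough_history_self (by omega) le_rfl (f * h)))
    have hI2 : Integrable (fun ω => G ω * discountedTrace κ f (fun i => z i ω) (n + τ) *
        h (z (n + τ + 1) ω)) ℙ :=
      hz.integrable (n := n + τ + 1) (factorsThrough_map₂ (· * ·)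
        (factorsThrough_history_mono (Nat.le_succ _) hGD)
        (factorsThrough_history_self (by omega) le_rfl h))
    have e1 : ∀ ω, G ω * (discountedTrace κ f (fun i => z i ω) (n + (τ + 1)) *
        h (z (n + (τ + 1)) ω)) = G ω * (f * h) (z (n + (τ + 1)) ω) +
        κ * (G ω * discountedTrace κ f (fun i => z i ω) (n + τ) * h (z (n + τ + 1) ω)) := by
      intro ω
      rw [← add_assoc, discountedTrace, Pi.mul_apply]
      ring
    simp only [e1]
    rw [integral_add hI1 (hI2.const_mul κ), integral_const_mul,
      hz.integral_mul_apply_add hn hG, hz.integral_mul_apply_succ (by omega) hGD]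
    simp only [mul_assoc] at ih ⊢
    rw [ih (K *ᵥ h)]
    have hI3 : Integrable (fun ω => G ω * ((K ^ (τ + 1)) *ᵥ (f * h)) (z n ω)) ℙ :=
      hz.integrable (n := n) (factorsThrough_map₂ (· * ·) hG
        (factorsThrough_history_self hn le_rfl ((K ^ (τ + 1)) *ᵥ (f * h))))
    have hI4 : Integrable (fun ω => G ω * ∑ k ∈ Finset.range τ,
        κ ^ k * ((K ^ (τ - k)) *ᵥ (f * ((K ^ k) *ᵥ (K *ᵥ h)))) (z n ω)) ℙ :=
      hz.integrable (n := n) (factorsThrough_map₂ (· * ·) hG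
        (factorsThrough_history_self hn le_rfl fun y => ∑ k ∈ Finset.range τ,
          κ ^ k * ((K ^ (τ - k)) *ᵥ (f * ((K ^ k) *ᵥ (K *ᵥ h)))) y))
    rw [mul_add, ← integral_const_mul, ← add_assoc, ← integral_add hI3 (hI4.const_mul κ),
      ← mul_assoc, ← pow_succ', Matrix.mulVec_mulVec, ← pow_succ]
    congr 1
    refine integral_congr_ae (Eventually.of_forall fun ω => ?_)
    simp only [Finset.sum_range_succ', pow_zero, one_mul, Matrix.one_mulVec, Nat.sub_zero,
      Nat.add_sub_add_right, Matrix.mulVec_mulVec, ← pow_succ, mul_add, Finset.mul_sum]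
    rw [add_comm]
    congr 1
    exact Finset.sum_congr rfl fun k _ => by ring

/-- Mixing, uniformly over the past: after a lag `τ` the product of the discounted trace of `f` with
`h` is nearly uncorrelated with every function `G` of the history. -/
theorem eventually_abs_integral_sub_le (hz : IsMarkovChain K ℙ z)
    (hK : K ∈ Matrix.rowStochastic ℝ Z)
    (hlim : ∀ y y', Tendsto (fun n => (K ^ n) y y') atTop (𝓝 (ν y')))
    (hκ0 : 0 ≤ κ) (hκ1 : κ < 1) (f h : Z → ℝ) {ε : ℝ} (hε : 0 < ε) :
    ∀ᶠ τ in atTop, ∀ n, 1 ≤ n → ∀ G : Ω → ℝ, G.FactorsThrough (history z n) →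
      |∫ ω, G ω * (discountedTrace κ f (fun i => z i ω) (n + τ) * h (z (n + τ) ω)) ∂ℙ -
        traceCorrelation K ν κ f h * ∫ ω, G ω ∂ℙ| ≤ ε * ∫ ω, |G ω| ∂ℙ := by
  obtain ⟨C, hC0, hC⟩ := exists_forall_abs_le h
  obtain ⟨B, hB0, hB⟩ := exists_forall_abs_le f
  have h1κ : 0 < 1 - κ := by linarith
  have hsum : ∀ᶠ τ in atTop, ∀ y, |(∑ k ∈ Finset.range τ,
      κ ^ k * ((K ^ (τ - k)) *ᵥ (f * ((K ^ k) *ᵥ h))) y) - traceCorrelation K ν κ f h| < ε / 2 := by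
    refine eventually_all.2 fun y => ?_
    have := (tendsto_sum_pow_mulVec_traceCorrelation hK hlim hκ0 hκ1 f h y)
    exact (Metric.tendsto_nhds.1 this) (ε / 2) (half_pos hε)
  have hpow : ∀ᶠ τ in atTop, κ ^ τ * (B / (1 - κ) * C) < ε / 2 := by
    have h1 := (tendsto_pow_atTop_nhds_zero_of_lt_one hκ0 hκ1).mul_const (B / (1 - κ) * C)
    rw [zero_mul] at h1
    exact h1.eventually_lt_const (half_pos hε)
  filter_upwards [hsum, hpow] with τ hτ hτ' n hn G hG
  have hGI := hz.integrable hG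
  rw [hz.integral_mul_discountedTrace hn hG, ← integral_const_mul, ← integral_const_mul]
  set S : Z → ℝ := fun y => ∑ k ∈ Finset.range τ,
    κ ^ k * ((K ^ (τ - k)) *ᵥ (f * ((K ^ k) *ᵥ h))) y with hS
  have hI1 : Integrable (fun ω => G ω * S (z n ω)) ℙ := hz.integrable (n := n)
    (factorsThrough_map₂ (· * ·) hG (factorsThrough_history_self hn le_rfl S))
  have hI2 : Integrable (fun ω => κ ^ τ * (G ω * (discountedTrace κ f (fun i => z i ω) n *
      ((K ^ τ) *ᵥ h) (z n ω)))) ℙ := Integrable.const_mul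
    (hz.integrable (n := n) (factorsThrough_map₂ (· * ·) hG
      (factorsThrough_map₂ (· * ·) (factorsThrough_discountedTrace κ f z n)
        (factorsThrough_history_self hn le_rfl ((K ^ τ) *ᵥ h))))) _
  change |∫ ω, G ω * S (z n ω) ∂ℙ + _ - _| ≤ _
  have hI12 : Integrable (fun ω => G ω * S (z n ω) + κ ^ τ * (G ω *
      (discountedTrace κ f (fun i => z i ω) n * ((K ^ τ) *ᵥ h) (z n ω)))) ℙ := hI1.add hI2
  rw [← integral_add hI1 hI2, ← integral_sub hI12 (hGI.const_mul _), ← integral_const_mul]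
  refine (abs_integral_le_integral_abs).trans (integral_mono (hI12.sub (hGI.const_mul _)).abs
    (hGI.abs.const_mul ε) fun ω => ?_)
  simp only
  have e : G ω * S (z n ω) + κ ^ τ * (G ω * (discountedTrace κ f (fun i => z i ω) n *
      ((K ^ τ) *ᵥ h) (z n ω))) - traceCorrelation K ν κ f h * G ω =
      ((S (z n ω) - traceCorrelation K ν κ f h) + κ ^ τ * (discountedTrace κ f (fun i => z i ω) n *
      ((K ^ τ) *ᵥ h) (z n ω))) * G ω := by ring
  rw [e, abs_mul]
  refine mul_le_mul_of_nonneg_right ((abs_add_le _ _).trans ?_) (abs_nonneg _)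
  have h1 := hτ (z n ω)
  have h2 : |κ ^ τ * (discountedTrace κ f (fun i => z i ω) n * ((K ^ τ) *ᵥ h) (z n ω))| ≤
      κ ^ τ * (B / (1 - κ) * C) := by
    rw [abs_mul, abs_of_nonneg (pow_nonneg hκ0 τ), abs_mul]
    refine mul_le_mul_of_nonneg_left ?_ (pow_nonneg hκ0 τ)
    exact mul_le_mul (abs_discountedTrace_le hκ0 hκ1 hB0 hB _ n) (abs_pow_mulVec_le hK hC τ _)
      (abs_nonneg _) (by positivity)
  linarith

end IsMarkovChain

/-! ### The steady-state matrix is positive definite -/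

lemma inner_eq_sum_smul {Z : Type*} {d : ℕ} (ψ : Z → EuclideanSpace ℝ (Fin d))
    (v : EuclideanSpace ℝ (Fin d)) :
    (fun y => inner ℝ (ψ y) v) = ∑ i, v i • fun y => ψ y i := by
  funext y
  simp [PiLp.inner_apply, Finset.sum_apply]

section TraceCorrelation

variable {Z ι : Type*} [Fintype Z] [DecidableEq Z] [Fintype ι] {K : Matrix Z Z ℝ} {ν : Z → ℝ}
  {κ γ : ℝ}

lemma traceCorrelation_add_right (hK : K ∈ Matrix.rowStochastic ℝ Z) (hκ0 : 0 ≤ κ) (hκ1 : κ < 1)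
    (f g h : Z → ℝ) :
    traceCorrelation K ν κ f (g + h) = traceCorrelation K ν κ f g + traceCorrelation K ν κ f h := by
  unfold traceCorrelation
  rw [← (summable_traceCorrelation hK hκ0 hκ1 ν f g).tsum_add
    (summable_traceCorrelation hK hκ0 hκ1 ν f h)]
  refine tsum_congr fun k => ?_
  simp only [Matrix.mulVec_add, Pi.add_apply, mul_add, Finset.sum_add_distrib]

lemma traceCorrelation_sum_left (hK : K ∈ Matrix.rowStochastic ℝ Z) (hκ0 : 0 ≤ κ) (hκ1 : κ < 1)
    (c : ι → ℝ) (f : ι → Z → ℝ) (h : Z → ℝ) :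
    traceCorrelation K ν κ (∑ i, c i • f i) h = ∑ i, c i * traceCorrelation K ν κ (f i) h := by
  unfold traceCorrelation
  simp only [← tsum_mul_left]
  rw [← Summable.tsum_finsetSum fun i _ =>
    (summable_traceCorrelation hK hκ0 hκ1 ν (f i) h).mul_left (c i)]
  refine tsum_congr fun k => ?_
  simp only [Finset.sum_apply, Pi.smul_apply, smul_eq_mul, Finset.sum_mul, Finset.mul_sum]
  rw [Finset.sum_comm]
  exact Finset.sum_congr rfl fun i _ => Finset.sum_congr rfl fun y _ => by ring

lemma traceCorrelation_sum_right (hK : K ∈ Matrix.rowStochastic ℝ Z) (hκ0 : 0 ≤ κ) (hκ1 : κ < 1)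
    (c : ι → ℝ) (f : Z → ℝ) (h : ι → Z → ℝ) :
    traceCorrelation K ν κ f (∑ i, c i • h i) = ∑ i, c i * traceCorrelation K ν κ f (h i) := by
  unfold traceCorrelation
  simp only [← tsum_mul_left]
  rw [← Summable.tsum_finsetSum fun i _ =>
    (summable_traceCorrelation hK hκ0 hκ1 ν f (h i)).mul_left (c i)]
  refine tsum_congr fun k => ?_
  simp only [Matrix.mulVec_sum, Matrix.mulVec_smul, Finset.sum_apply, Pi.smul_apply, smul_eq_mul,
    Finset.mul_sum]
  rw [Finset.sum_comm]
  exact Finset.sum_congr rfl fun i _ => Finset.sum_congr rfl fun y _ => by ring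

lemma abs_sum_mul_pow_mulVec_le (hK : K ∈ Matrix.rowStochastic ℝ Z) (hν0 : ∀ y, 0 ≤ ν y)
    (hν : ν ᵥ* K = ν) (f : Z → ℝ) (k : ℕ) :
    |∑ y, ν y * (f y * ((K ^ k) *ᵥ f) y)| ≤ ∑ y, ν y * f y ^ 2 := by
  have hKk := pow_mem hK k
  have h1 : ∑ y, ν y * (f y * ((K ^ k) *ᵥ f) y) =
      ∑ y, ∑ y', ν y * (K ^ k) y y' * (f y * f y') := by
    simp only [Matrix.mulVec, dotProduct, Finset.mul_sum]
    exact Finset.sum_congr rfl fun y _ => Finset.sum_congr rfl fun y' _ => by ring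
  have h2 : ∑ y, ∑ y', ν y * (K ^ k) y y' * f y ^ 2 = ∑ y, ν y * f y ^ 2 := by
    refine Finset.sum_congr rfl fun y _ => ?_
    rw [← Finset.sum_mul, ← Finset.mul_sum, Matrix.sum_row_of_mem_rowStochastic hKk, mul_one]
  have h3 : ∑ y, ∑ y', ν y * (K ^ k) y y' * f y' ^ 2 = ∑ y, ν y * f y ^ 2 := by
    rw [Finset.sum_comm]
    refine Finset.sum_congr rfl fun y' _ => ?_
    rw [← Finset.sum_mul]
    congr 1
    exact congrFun (vecMul_pow_eq hν k) y'
  rw [h1]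
  calc _ ≤ ∑ y, ∑ y', |ν y * (K ^ k) y y' * (f y * f y')| :=
        (Finset.abs_sum_le_sum_abs _ _).trans
          (Finset.sum_le_sum fun y _ => Finset.abs_sum_le_sum_abs _ _)
    _ ≤ ∑ y, ∑ y', (ν y * (K ^ k) y y' * f y ^ 2 / 2 + ν y * (K ^ k) y y' * f y' ^ 2 / 2) := by
        refine Finset.sum_le_sum fun y _ => Finset.sum_le_sum fun y' _ => ?_
        have h0 : 0 ≤ ν y * (K ^ k) y y' := mul_nonneg (hν0 y) (hKk.1 y y')
        rw [abs_mul, abs_of_nonneg h0]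
        have : |f y * f y'| ≤ (f y ^ 2 + f y' ^ 2) / 2 := by
          rw [abs_le]
          constructor <;> nlinarith [sq_nonneg (f y + f y'), sq_nonneg (f y - f y')]
        have := mul_le_mul_of_nonneg_left this h0
        linarith
    _ = ∑ y, ν y * f y ^ 2 := by
        simp only [Finset.sum_add_distrib, ← Finset.sum_div, h2, h3]
        ring

/-- With `a k = E [f (z 0) * f (z k)]`, of modulus at most `a 0`, the left-hand side is
`a 0 - (γ - κ) * ∑ κ ^ k * a (k + 1)`, and the sum is at most `a 0 / (1 - κ)`. -/
theorem le_traceCorrelation_sub_smul_mulVec (hK : K ∈ Matrix.rowStochastic ℝ Z)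
    (hν0 : ∀ y, 0 ≤ ν y) (hν : ν ᵥ* K = ν) (hκ0 : 0 ≤ κ) (hκγ : κ ≤ γ) (hγ1 : γ < 1) (f : Z → ℝ) :
    (1 - γ) * ∑ y, ν y * f y ^ 2 ≤ traceCorrelation K ν κ f (f - γ • K *ᵥ f) := by
  have hκ1 : κ < 1 := hκγ.trans_lt hγ1
  set a : ℕ → ℝ := fun k => ∑ y, ν y * (f y * ((K ^ k) *ᵥ f) y) with ha
  have ha0 : a 0 = ∑ y, ν y * f y ^ 2 := by simp [ha, pow_two]
  have hak : ∀ k, |a k| ≤ a 0 := fun k => ha0 ▸ abs_sum_mul_pow_mulVec_le hK hν0 hν f k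
  have ha0' : 0 ≤ a 0 := (abs_nonneg _).trans (hak 0)
  have hs : Summable fun k => κ ^ k * a k := summable_traceCorrelation hK hκ0 hκ1 ν f f
  have hgeo := (summable_geometric_of_lt_one hκ0 hκ1).mul_right (a 0)
  have hs1 : Summable fun k => κ ^ k * a (k + 1) := by
    refine Summable.of_norm_bounded hgeo fun k => ?_
    rw [Real.norm_eq_abs, abs_mul, abs_of_nonneg (pow_nonneg hκ0 k)]
    exact mul_le_mul_of_nonneg_left (hak _) (pow_nonneg hκ0 k)
  have e1 : traceCorrelation K ν κ f (f - γ • K *ᵥ f) =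
      ∑' k, κ ^ k * a k - γ * ∑' k, κ ^ k * a (k + 1) := by
    rw [← tsum_mul_left, ← hs.tsum_sub (hs1.mul_left γ)]
    refine tsum_congr fun k => ?_
    simp only [ha, Matrix.mulVec_sub, Matrix.mulVec_smul, Matrix.mulVec_mulVec, ← pow_succ,
      Pi.sub_apply, Pi.smul_apply, smul_eq_mul, mul_sub, Finset.sum_sub_distrib, Finset.mul_sum]
    congr 1
    exact Finset.sum_congr rfl fun y _ => by ring
  have e2 : ∑' k, κ ^ k * a k = a 0 + κ * ∑' k, κ ^ k * a (k + 1) := by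
    rw [hs.tsum_eq_zero_add, ← tsum_mul_left]
    simp only [pow_zero, one_mul, pow_succ']
    congr 1
    exact tsum_congr fun k => by ring
  have h1κ : 0 < 1 - κ := by linarith
  have e3 : ∑' k, κ ^ k * a (k + 1) ≤ a 0 / (1 - κ) := by
    calc ∑' k, κ ^ k * a (k + 1) ≤ ∑' k, κ ^ k * a 0 := hs1.tsum_le_tsum (fun k =>
          mul_le_mul_of_nonneg_left ((le_abs_self _).trans (hak _)) (pow_nonneg hκ0 k)) hgeo
      _ = a 0 / (1 - κ) := by
          rw [tsum_mul_right, tsum_geometric_of_lt_one hκ0 hκ1, inv_mul_eq_div]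
  have e4 : (γ - κ) * (∑' k, κ ^ k * a (k + 1)) ≤ (γ - κ) * (a 0 / (1 - κ)) :=
    mul_le_mul_of_nonneg_left e3 (by linarith)
  have e5 : (1 - γ) * a 0 ≤ a 0 - (γ - κ) * (a 0 / (1 - κ)) := by
    have : a 0 - (γ - κ) * (a 0 / (1 - κ)) = (1 - γ) * a 0 / (1 - κ) := by
      field_simp
      ring
    rw [this, le_div_iff₀ h1κ]
    have : 0 ≤ (1 - γ) * a 0 := mul_nonneg (by linarith) ha0'
    nlinarith
  rw [e1, e2, ← ha0]
  linarith

/-- The matrix of the steady-state equation of TD(λ), with `κ = λ γ`, for the chain with transition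
matrix `K`, stationary law `ν` and features `ψ`. -/
noncomputable def tdMatrix {d : ℕ} (K : Matrix Z Z ℝ) (ν : Z → ℝ) (κ γ : ℝ)
    (ψ : Z → EuclideanSpace ℝ (Fin d)) : Matrix (Fin d) (Fin d) ℝ :=
  fun i j => traceCorrelation K ν κ (fun y => ψ y i) ((fun y => ψ y j) - γ • K *ᵥ fun y => ψ y j)

variable {d : ℕ} {ψ : Z → EuclideanSpace ℝ (Fin d)}

lemma sum_tdMatrix_mul (hK : K ∈ Matrix.rowStochastic ℝ Z) (hκ0 : 0 ≤ κ) (hκ1 : κ < 1)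
    (f : Z → ℝ) (v : EuclideanSpace ℝ (Fin d)) :
    ∑ j, v j * traceCorrelation K ν κ f ((fun y => ψ y j) - γ • K *ᵥ fun y => ψ y j) =
      traceCorrelation K ν κ f
        ((fun y => inner ℝ (ψ y) v) - γ • K *ᵥ fun y => inner ℝ (ψ y) v) := by
  rw [← traceCorrelation_sum_right hK hκ0 hκ1]
  congr 1
  rw [inner_eq_sum_smul ψ v, Matrix.mulVec_sum, Finset.smul_sum, ← Finset.sum_sub_distrib]
  refine Finset.sum_congr rfl fun j _ => ?_
  rw [Matrix.mulVec_smul, smul_sub, smul_comm]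

lemma sum_sum_tdMatrix_mul (hK : K ∈ Matrix.rowStochastic ℝ Z) (hκ0 : 0 ≤ κ) (hκ1 : κ < 1)
    (v : EuclideanSpace ℝ (Fin d)) :
    ∑ i, ∑ j, tdMatrix K ν κ γ ψ i j * (v i * v j) = traceCorrelation K ν κ
      (fun y => inner ℝ (ψ y) v)
      ((fun y => inner ℝ (ψ y) v) - γ • K *ᵥ fun y => inner ℝ (ψ y) v) := by
  rw [← sum_tdMatrix_mul hK hκ0 hκ1]
  conv_rhs => rw [inner_eq_sum_smul ψ v]
  simp only [traceCorrelation_sum_left hK hκ0 hκ1, Finset.mul_sum]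
  rw [Finset.sum_comm]
  exact Finset.sum_congr rfl fun j _ => Finset.sum_congr rfl fun i _ => by
    rw [tdMatrix]; ring

/-- Coercivity of the steady-state matrix, by compactness of the unit sphere. -/
theorem exists_pos_mul_norm_sq_le_tdMatrix (hK : K ∈ Matrix.rowStochastic ℝ Z)
    (hν0 : ∀ y, 0 ≤ ν y) (hν : ν ᵥ* K = ν) (hκ0 : 0 ≤ κ) (hκγ : κ ≤ γ) (hγ1 : γ < 1)
    (hψ : ∀ v : EuclideanSpace ℝ (Fin d), v ≠ 0 → 0 < ∑ y, ν y * (inner ℝ (ψ y) v) ^ 2) :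
    ∃ β > 0, ∀ v : EuclideanSpace ℝ (Fin d),
      β * ‖v‖ ^ 2 ≤ ∑ i, ∑ j, tdMatrix K ν κ γ ψ i j * (v i * v j) := by
  have hκ1 : κ < 1 := hκγ.trans_lt hγ1
  obtain ⟨b, hb0, hb⟩ : ∃ b > 0, ∀ v : EuclideanSpace ℝ (Fin d), ‖v‖ = 1 →
      b ≤ ∑ y, ν y * (inner ℝ (ψ y) v) ^ 2 := by
    have hcont : Continuous fun v : EuclideanSpace ℝ (Fin d) =>
        ∑ y, ν y * (inner ℝ (ψ y) v) ^ 2 := by fun_prop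
    rcases (Metric.sphere (0 : EuclideanSpace ℝ (Fin d)) 1).eq_empty_or_nonempty with h | h
    · exact ⟨1, one_pos, fun v hv =>
        absurd (show v ∈ Metric.sphere 0 1 by simpa using hv) (by simp [h])⟩
    · obtain ⟨v₀, hv₀, hmin⟩ := (isCompact_sphere (0 : EuclideanSpace ℝ (Fin d)) 1).exists_isMinOn h
        hcont.continuousOn
      refine ⟨_, hψ v₀ ?_, fun v hv => hmin (show v ∈ Metric.sphere 0 1 by simpa using hv)⟩
      rintro rfl
      simp at hv₀
  refine ⟨(1 - γ) * b, mul_pos (by linarith) hb0, fun v => ?_⟩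
  rw [sum_sum_tdMatrix_mul hK hκ0 hκ1]
  refine le_trans ?_ (le_traceCorrelation_sub_smul_mulVec hK hν0 hν hκ0 hκγ hγ1 _)
  rw [mul_assoc]
  refine mul_le_mul_of_nonneg_left ?_ (by linarith)
  rcases eq_or_ne v 0 with rfl | hv
  · simp
  · have hn : ‖v‖ ≠ 0 := norm_ne_zero_iff.2 hv
    have h1 := hb (‖v‖⁻¹ • v) (by rw [norm_smul, norm_inv, norm_norm, inv_mul_cancel₀ hn])
    have h2 := mul_le_mul_of_nonneg_right h1 (sq_nonneg ‖v‖)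
    refine h2.trans (le_of_eq ?_)
    rw [Finset.sum_mul]
    refine Finset.sum_congr rfl fun y _ => ?_
    rw [inner_smul_right]
    field_simp

end TraceCorrelation

lemma Matrix.existsUnique_mulVec_eq_of_coercive {d : ℕ}
    {A : Matrix (Fin d) (Fin d) ℝ} {β : ℝ} (hβ : 0 < β)
    (hA : ∀ v : EuclideanSpace ℝ (Fin d), β * ‖v‖ ^ 2 ≤ ∑ i, ∑ j, A i j * (v i * v j))
    (b : Fin d → ℝ) :
    ∃ w : EuclideanSpace ℝ (Fin d), ∀ v : EuclideanSpace ℝ (Fin d),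
      (A *ᵥ fun j => v j) = b ↔ v = w := by
  have hinj : Function.Injective A.mulVec := by
    refine (injective_iff_map_eq_zero A.mulVecLin).2 fun v hv => ?_
    have h1 := hA (WithLp.toLp 2 v)
    have h2 : ∑ i, ∑ j, A i j * (v i * v j) = v ⬝ᵥ (A *ᵥ v) := by
      simp only [dotProduct, Matrix.mulVec, Finset.mul_sum]
      exact Finset.sum_congr rfl fun i _ => Finset.sum_congr rfl fun j _ => by ring
    have h3 : A *ᵥ v = 0 := hv
    simp only [h2, h3, dotProduct_zero] at h1
    have h4 : ‖WithLp.toLp 2 v‖ = 0 := by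
      by_contra h
      have : 0 < ‖WithLp.toLp 2 v‖ := lt_of_le_of_ne (norm_nonneg _) (Ne.symm h)
      have : 0 < β * ‖WithLp.toLp 2 v‖ ^ 2 := by positivity
      linarith
    simpa using h4
  have hsurj : Function.Surjective A.mulVec :=
    (LinearMap.injective_iff_surjective (f := A.mulVecLin)).1 hinj
  obtain ⟨w, hw⟩ := hsurj b
  refine ⟨WithLp.toLp 2 w, fun v => ⟨fun h => ?_, fun h => ?_⟩⟩
  · ext j
    exact congrFun (hinj (h.trans hw.symm)) j
  · rw [h]
    exact hw

/-! ### Mean-square convergence along a Markov chain -/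

/-- An implicit step is an explicit step whose size is damped by `1 + α * ‖e‖ ^ 2`. -/
lemma eq_add_smul_of_implicit {E : Type*} [NormedAddCommGroup E] [InnerProductSpace ℝ E] {α ρ : ℝ}
    (hα : 0 ≤ α) {e v v' : E} (h : v' = v + (α * (ρ - inner ℝ e v')) • e) :
    v' = v + (α / (1 + α * ‖e‖ ^ 2)) • ((ρ - inner ℝ e v) • e) := by
  have hpos : 0 < 1 + α * ‖e‖ ^ 2 := by positivity
  have h1 : inner ℝ e v' = inner ℝ e v + α * (ρ - inner ℝ e v') * ‖e‖ ^ 2 := by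
    conv_lhs => rw [h]
    rw [inner_add_right, inner_smul_right, real_inner_self_eq_norm_sq]
  have h2 : α * (ρ - inner ℝ e v') = α / (1 + α * ‖e‖ ^ 2) * (ρ - inner ℝ e v) := by
    field_simp
    linear_combination -α * h1
  rw [smul_smul, ← h2]
  exact h

lemma eligibilityTrace_apply {Z : Type*} {d : ℕ} (γ lam : ℝ) (ψ : Z → EuclideanSpace ℝ (Fin d))
    (z : ℕ → Z) (n : ℕ) (i : Fin d) :
    eligibilityTrace γ lam ψ z n i = discountedTrace (lam * γ) (fun y => ψ y i) z n := by
  induction n with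
  | zero => rfl
  | succ n ih => simp [eligibilityTrace, discountedTrace, ih]

lemma norm_eligibilityTrace_le {Z : Type*} {d : ℕ} {γ lam : ℝ} (h0 : 0 ≤ lam * γ)
    (h1 : lam * γ < 1) {ψ : Z → EuclideanSpace ℝ (Fin d)} (hψ : ∀ y, ‖ψ y‖ ≤ 1) (z : ℕ → Z)
    (n : ℕ) : ‖eligibilityTrace γ lam ψ z n‖ ≤ 1 / (1 - lam * γ) := by
  have hpos : 0 < 1 - lam * γ := by linarith
  induction n with
  | zero => simpa [eligibilityTrace] using hpos.le
  | succ n ih =>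
    have h2 : ‖eligibilityTrace γ lam ψ z (n + 1)‖ ≤ 1 + lam * γ * (1 / (1 - lam * γ)) := by
      refine (norm_add_le _ _).trans (add_le_add (hψ _) ?_)
      rw [norm_smul, Real.norm_eq_abs, abs_of_nonneg h0]
      exact mul_le_mul_of_nonneg_left ih h0
    refine h2.trans (le_of_eq ?_)
    field_simp
    ring

lemma factorsThrough_eligibilityTrace {Ω Z : Type*} {d : ℕ} (γ lam : ℝ)
    (ψ : Z → EuclideanSpace ℝ (Fin d)) (z : ℕ → Ω → Z) (n : ℕ) :
    (fun ω => eligibilityTrace γ lam ψ (fun i => z i ω) n).FactorsThrough (history z n) := by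
  intro ω ω' h
  ext i
  simp only [eligibilityTrace_apply]
  exact factorsThrough_discountedTrace (lam * γ) (fun y => ψ y i) z n h

section Chain

variable {Ω Z : Type*} [MeasurableSpace Ω] [Fintype Z] [DecidableEq Z] [MeasurableSpace Z]
  [MeasurableSingletonClass Z] {K : Matrix Z Z ℝ} {ℙ : Measure Ω} [IsProbabilityMeasure ℙ]
  {z : ℕ → Ω → Z} {ν : Z → ℝ} {κ : ℝ}

/-- Mixing for a product that also involves the state one step ahead. -/
lemma IsMarkovChain.eventually_abs_integral_succ_sub_le (hz : IsMarkovChain K ℙ z)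
    (hK : K ∈ Matrix.rowStochastic ℝ Z)
    (hlim : ∀ y y', Tendsto (fun n => (K ^ n) y y') atTop (𝓝 (ν y')))
    (hκ0 : 0 ≤ κ) (hκ1 : κ < 1) (f q g : Z → ℝ) (c : ℝ) {ε : ℝ} (hε : 0 < ε) :
    ∀ᶠ τ in atTop, ∀ n, 1 ≤ n → ∀ G : Ω → ℝ, G.FactorsThrough (history z n) →
      |∫ ω, G ω * (discountedTrace κ f (fun i => z i ω) (n + τ) *
          (q (z (n + τ) ω) + c * g (z (n + τ + 1) ω))) ∂ℙ -
        traceCorrelation K ν κ f (q + c • K *ᵥ g) * ∫ ω, G ω ∂ℙ| ≤ ε * ∫ ω, |G ω| ∂ℙ := by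
  filter_upwards [hz.eventually_abs_integral_sub_le hK hlim hκ0 hκ1 f (q + c • K *ᵥ g) hε]
    with τ hτ n hn G hG
  have h := hτ n hn G hG
  have hGD : (fun ω => G ω * discountedTrace κ f (fun i => z i ω) (n + τ)).FactorsThrough
      (history z (n + τ)) := factorsThrough_map₂ (· * ·)
    (factorsThrough_history_mono (Nat.le_add_right n τ) hG)
    (factorsThrough_discountedTrace κ f z (n + τ))
  have hI : ∀ h : Z → ℝ, Integrable (fun ω => G ω * discountedTrace κ f (fun i => z i ω) (n + τ) *
      h (z (n + τ) ω)) ℙ := fun h => hz.integrable (n := n + τ)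
    (factorsThrough_map₂ (· * ·) hGD (factorsThrough_history_self (by omega) le_rfl h))
  have hI' : Integrable (fun ω => G ω * discountedTrace κ f (fun i => z i ω) (n + τ) *
      g (z (n + τ + 1) ω)) ℙ := hz.integrable (n := n + τ + 1) (factorsThrough_map₂ (· * ·)
    (factorsThrough_history_mono (Nat.le_succ _) hGD)
    (factorsThrough_history_self (by omega) le_rfl g))
  have e : ∫ ω, G ω * (discountedTrace κ f (fun i => z i ω) (n + τ) *
      (q (z (n + τ) ω) + c * g (z (n + τ + 1) ω))) ∂ℙ =
      ∫ ω, G ω * (discountedTrace κ f (fun i => z i ω) (n + τ) *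
        (q + c • K *ᵥ g) (z (n + τ) ω)) ∂ℙ := by
    have e1 : ∀ ω, G ω * (discountedTrace κ f (fun i => z i ω) (n + τ) *
        (q (z (n + τ) ω) + c * g (z (n + τ + 1) ω))) =
        G ω * discountedTrace κ f (fun i => z i ω) (n + τ) * q (z (n + τ) ω) +
        c * (G ω * discountedTrace κ f (fun i => z i ω) (n + τ) * g (z (n + τ + 1) ω)) :=
      fun ω => by ring
    have e2 : ∀ ω, G ω * (discountedTrace κ f (fun i => z i ω) (n + τ) *
        (q + c • K *ᵥ g) (z (n + τ) ω)) =
        G ω * discountedTrace κ f (fun i => z i ω) (n + τ) * q (z (n + τ) ω) +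
        c * (G ω * discountedTrace κ f (fun i => z i ω) (n + τ) * (K *ᵥ g) (z (n + τ) ω)) :=
      fun ω => by simp only [Pi.add_apply, Pi.smul_apply, smul_eq_mul]; ring
    simp only [e1, e2]
    rw [integral_add (hI q) (hI'.const_mul c), integral_add (hI q) ((hI (K *ᵥ g)).const_mul c),
      integral_const_mul, integral_const_mul, hz.integral_mul_apply_succ (by omega) hGD]
  rw [e]
  exact h

/-- The lagged drift of TD(λ), in the error coordinate `u`, is dissipative in mean up to `ε`:
its linear part has mean `-tdMatrix`, and its constant part has mean zero because `wstar` solves the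
steady-state equation. -/
lemma IsMarkovChain.exists_lag_integral_inner_le {d : ℕ} {γ lam β : ℝ} (hz : IsMarkovChain K ℙ z)
    (hK : K ∈ Matrix.rowStochastic ℝ Z)
    (hlim : ∀ y y', Tendsto (fun n => (K ^ n) y y') atTop (𝓝 (ν y')))
    (hκ0 : 0 ≤ lam * γ) (hκ1 : lam * γ < 1) {ψ : Z → EuclideanSpace ℝ (Fin d)} {r : Z → ℝ}
    (hβ : ∀ v : EuclideanSpace ℝ (Fin d),
      β * ‖v‖ ^ 2 ≤ ∑ i, ∑ j, tdMatrix K ν (lam * γ) γ ψ i j * (v i * v j))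
    {wstar : EuclideanSpace ℝ (Fin d)}
    (hw : (tdMatrix K ν (lam * γ) γ ψ *ᵥ fun j => wstar j) =
      fun i => traceCorrelation K ν (lam * γ) (fun y => ψ y i) r)
    {u : ℕ → Ω → EuclideanSpace ℝ (Fin d)}
    (hu : ∀ n, 1 ≤ n → (u n).FactorsThrough (history z n)) {ε : ℝ} (hε : 0 < ε) :
    ∃ τ, ∀ n, 1 ≤ n → ∫ ω, inner ℝ (u n ω)
        ((r (z (n + τ) ω) - inner ℝ (ψ (z (n + τ) ω)) (wstar + u n ω) +
          γ * inner ℝ (ψ (z (n + τ + 1) ω)) (wstar + u n ω)) •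
            eligibilityTrace γ lam ψ (fun i => z i ω) (n + τ)) ∂ℙ ≤
      -β * ∫ ω, ‖u n ω‖ ^ 2 ∂ℙ + ε * (1 + ∫ ω, ‖u n ω‖ ^ 2 ∂ℙ) := by
  set κ := lam * γ with hκ
  set b : Z → ℝ := fun y => inner ℝ (ψ y) wstar with hb
  have hnoise : ∀ i, traceCorrelation K ν κ (fun y => ψ y i) ((r - b) + γ • K *ᵥ b) = 0 := by
    intro i
    have h1 := congrFun hw i
    have h2 : (tdMatrix K ν κ γ ψ *ᵥ fun j => wstar j) i =
        traceCorrelation K ν κ (fun y => ψ y i) (b - γ • K *ᵥ b) := by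
      rw [hb, ← sum_tdMatrix_mul hK hκ0 hκ1]
      change ∑ j, tdMatrix K ν κ γ ψ i j * wstar j = _
      exact Finset.sum_congr rfl fun j _ => mul_comm _ _
    have h3 := traceCorrelation_add_right (ν := ν) hK hκ0 hκ1 (fun y => ψ y i)
      ((r - b) + γ • K *ᵥ b) (b - γ • K *ᵥ b)
    rw [show (r - b) + γ • K *ᵥ b + (b - γ • K *ᵥ b) = r by abel] at h3
    linarith
  set ε' : ℝ := ε / (d + d * d + 1) with hε'
  have hε'0 : 0 < ε' := by positivity
  have hA := eventually_all.2 fun i : Fin d => hz.eventually_abs_integral_succ_sub_le hK hlim hκ0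
    hκ1 (fun y => ψ y i) (r - b) b γ hε'0
  have hB := eventually_all.2 fun i : Fin d => eventually_all.2 fun j : Fin d =>
    hz.eventually_abs_integral_succ_sub_le hK hlim hκ0 hκ1 (fun y => ψ y i) (fun y => ψ y j)
      (fun y => ψ y j) (-γ) hε'0
  obtain ⟨τ, hτA, hτB⟩ := (hA.and hB).exists
  refine ⟨τ, fun n hn => ?_⟩
  have hui : ∀ i, (fun ω => u n ω i).FactorsThrough (history z n) := fun i ω ω' e => by
    simp only [hu n hn e]
  have huij : ∀ i j, (fun ω => u n ω i * u n ω j).FactorsThrough (history z n) := fun i j =>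
    factorsThrough_map₂ (· * ·) (hui i) (hui j)
  have hunorm : Integrable (fun ω => ‖u n ω‖ ^ 2) ℙ :=
    hz.integrable (n := n) fun ω ω' e => by simp only [hu n hn e]
  have hD : ∀ i, (fun ω => discountedTrace κ (fun y => ψ y i) (fun k => z k ω)
      (n + τ)).FactorsThrough (history z (n + τ + 1)) := fun i =>
    factorsThrough_history_mono (Nat.le_succ _) (factorsThrough_discountedTrace κ _ z (n + τ))
  have hnext : ∀ (q g : Z → ℝ) (c : ℝ), (fun ω => q (z (n + τ) ω) +
      c * g (z (n + τ + 1) ω)).FactorsThrough (history z (n + τ + 1)) := fun q g c =>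
    factorsThrough_map₂ (fun s t : ℝ => s + c * t)
      (factorsThrough_history_self (by omega) (by omega) q)
      (factorsThrough_history_self (by omega) le_rfl g)
  have hint : ∀ (G : Ω → ℝ) (q g : Z → ℝ) (c : ℝ) (i : Fin d), G.FactorsThrough (history z n) →
      Integrable (fun ω => G ω * (discountedTrace κ (fun y => ψ y i) (fun k => z k ω) (n + τ) *
        (q (z (n + τ) ω) + c * g (z (n + τ + 1) ω)))) ℙ := fun G q g c i hG =>
    hz.integrable (n := n + τ + 1) (factorsThrough_map₂ (· * ·)
      (factorsThrough_history_mono (by omega) hG) (factorsThrough_map₂ (· * ·) (hD i)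
        (hnext q g c)))
  -- the drift expanded in coordinates
  have hexp : ∀ ω, inner ℝ (u n ω)
        ((r (z (n + τ) ω) - inner ℝ (ψ (z (n + τ) ω)) (wstar + u n ω) +
          γ * inner ℝ (ψ (z (n + τ + 1) ω)) (wstar + u n ω)) •
            eligibilityTrace γ lam ψ (fun i => z i ω) (n + τ)) =
      (∑ i, u n ω i * (discountedTrace κ (fun y => ψ y i) (fun k => z k ω) (n + τ) *
        ((r - b) (z (n + τ) ω) + γ * b (z (n + τ + 1) ω)))) -
      ∑ i, ∑ j, u n ω i * u n ω j * (discountedTrace κ (fun y => ψ y i) (fun k => z k ω) (n + τ) *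
        (ψ (z (n + τ) ω) j + -γ * ψ (z (n + τ + 1) ω) j)) := by
    intro ω
    have e1 : ∀ y, inner ℝ (ψ y) (u n ω) = ∑ j, u n ω j * ψ y j := fun y => by
      simpa using congrFun (inner_eq_sum_smul ψ (u n ω)) y
    have e2 : inner ℝ (u n ω) (eligibilityTrace γ lam ψ (fun i => z i ω) (n + τ)) =
        ∑ i, u n ω i * discountedTrace κ (fun y => ψ y i) (fun k => z k ω) (n + τ) := by
      rw [PiLp.inner_apply]
      refine Finset.sum_congr rfl fun i _ => ?_
      rw [eligibilityTrace_apply, ← hκ]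
      simp [mul_comm (u n ω i)]
    have e3 : ∑ i, ∑ j, u n ω i * u n ω j * (discountedTrace κ (fun y => ψ y i) (fun k => z k ω)
        (n + τ) * (ψ (z (n + τ) ω) j + -γ * ψ (z (n + τ + 1) ω) j)) =
        (∑ i, u n ω i * discountedTrace κ (fun y => ψ y i) (fun k => z k ω) (n + τ)) *
        (inner ℝ (ψ (z (n + τ) ω)) (u n ω) - γ * inner ℝ (ψ (z (n + τ + 1) ω)) (u n ω)) := by
      rw [e1, e1, Finset.mul_sum, ← Finset.sum_sub_distrib, Finset.sum_mul_sum]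
      exact Finset.sum_congr rfl fun i _ => Finset.sum_congr rfl fun j _ => by ring
    have e4 : ∑ i, u n ω i * (discountedTrace κ (fun y => ψ y i) (fun k => z k ω) (n + τ) *
        ((r - b) (z (n + τ) ω) + γ * b (z (n + τ + 1) ω))) =
        (∑ i, u n ω i * discountedTrace κ (fun y => ψ y i) (fun k => z k ω) (n + τ)) *
        ((r - b) (z (n + τ) ω) + γ * b (z (n + τ + 1) ω)) := by
      rw [Finset.sum_mul]
      exact Finset.sum_congr rfl fun i _ => by ring
    rw [e3, e4, inner_smul_right, e2, inner_add_right, inner_add_right, Pi.sub_apply]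
    ring
  have hI1 := fun i => hint _ (r - b) b γ i (hui i)
  have hI2 := fun i j => hint _ (fun y => ψ y j) (fun y => ψ y j) (-γ) i (huij i j)
  simp only [hexp]
  rw [integral_sub (integrable_finsetSum _ fun i _ => hI1 i)
      (integrable_finsetSum _ fun i _ => integrable_finsetSum _ fun j _ => hI2 i j),
    integral_finsetSum _ fun i _ => hI1 i,
    integral_finsetSum _ fun i _ => integrable_finsetSum _ fun j _ => hI2 i j]
  simp only [integral_finsetSum _ fun j _ => hI2 _ j]
  set V := ∫ ω, ‖u n ω‖ ^ 2 ∂ℙ with hV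
  have hV0 : 0 ≤ V := integral_nonneg fun ω => by positivity
  have hcoord : ∀ i ω, |u n ω i| ≤ ‖u n ω‖ := fun i ω => by
    simpa using PiLp.norm_apply_le (u n ω) i
  have habs1 : ∀ i, ∫ ω, |u n ω i| ∂ℙ ≤ 1 + V := by
    intro i
    have : ∫ ω, (1 + ‖u n ω‖ ^ 2) ∂ℙ = 1 + V := by
      rw [integral_add (integrable_const 1) hunorm]; simp [hV]
    rw [← this]
    refine integral_mono (hz.integrable (hui i)).abs ((integrable_const 1).add hunorm) fun ω => ?_
    have h1 := hcoord i ω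
    simp only
    nlinarith [sq_nonneg (‖u n ω‖ - 1)]
  have habs2 : ∀ i j, ∫ ω, |u n ω i * u n ω j| ∂ℙ ≤ 1 + V := by
    intro i j
    refine le_trans ?_ (by linarith : V ≤ 1 + V)
    refine integral_mono (hz.integrable (huij i j)).abs hunorm fun ω => ?_
    simp only [abs_mul, pow_two]
    exact mul_le_mul (hcoord i ω) (hcoord j ω) (abs_nonneg _) (norm_nonneg _)
  have hS1 : ∑ i, ∫ ω, u n ω i * (discountedTrace κ (fun y => ψ y i) (fun k => z k ω) (n + τ) *
      ((r - b) (z (n + τ) ω) + γ * b (z (n + τ + 1) ω))) ∂ℙ ≤ d * (ε' * (1 + V)) := by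
    have : ∀ i ∈ (Finset.univ : Finset (Fin d)), ∫ ω, u n ω i * (discountedTrace κ (fun y => ψ y i)
        (fun k => z k ω) (n + τ) * ((r - b) (z (n + τ) ω) + γ * b (z (n + τ + 1) ω))) ∂ℙ ≤
        ε' * (1 + V) := fun i _ => by
      have h1 := hτA i n hn _ (hui i)
      rw [hnoise, zero_mul, sub_zero] at h1
      exact (le_abs_self _).trans (h1.trans (mul_le_mul_of_nonneg_left (habs1 i) hε'0.le))
    simpa using Finset.sum_le_sum this
  have hS2 : (∑ i, ∑ j, tdMatrix K ν κ γ ψ i j * ∫ ω, u n ω i * u n ω j ∂ℙ) -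
      d * (d * (ε' * (1 + V))) ≤ ∑ i, ∑ j, ∫ ω, u n ω i * u n ω j *
        (discountedTrace κ (fun y => ψ y i) (fun k => z k ω) (n + τ) *
        (ψ (z (n + τ) ω) j + -γ * ψ (z (n + τ + 1) ω) j)) ∂ℙ := by
    have : ∀ i ∈ (Finset.univ : Finset (Fin d)), ∀ j ∈ (Finset.univ : Finset (Fin d)),
        tdMatrix K ν κ γ ψ i j * ∫ ω, u n ω i * u n ω j ∂ℙ - ε' * (1 + V) ≤
        ∫ ω, u n ω i * u n ω j * (discountedTrace κ (fun y => ψ y i) (fun k => z k ω) (n + τ) *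
        (ψ (z (n + τ) ω) j + -γ * ψ (z (n + τ + 1) ω) j)) ∂ℙ := fun i _ j _ => by
      have h1 := hτB i j n hn _ (huij i j)
      rw [neg_smul, ← sub_eq_add_neg] at h1
      have h2 := (abs_le.1 (h1.trans (mul_le_mul_of_nonneg_left (habs2 i j) hε'0.le))).1
      rw [tdMatrix]
      linarith
    have := Finset.sum_le_sum fun i hi => Finset.sum_le_sum (this i hi)
    simpa [Finset.sum_sub_distrib] using this
  have hS3 : β * V ≤ ∑ i, ∑ j, tdMatrix K ν κ γ ψ i j * ∫ ω, u n ω i * u n ω j ∂ℙ := by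
    have hI3 := fun i j => (hz.integrable (huij i j)).const_mul (tdMatrix K ν κ γ ψ i j)
    have e : ∑ i, ∑ j, tdMatrix K ν κ γ ψ i j * ∫ ω, u n ω i * u n ω j ∂ℙ =
        ∫ ω, ∑ i, ∑ j, tdMatrix K ν κ γ ψ i j * (u n ω i * u n ω j) ∂ℙ := by
      rw [integral_finsetSum _ fun i _ => integrable_finsetSum _ fun j _ => hI3 i j]
      simp only [integral_finsetSum _ fun j _ => hI3 _ j, integral_const_mul]
    rw [e, hV, ← integral_const_mul]
    exact integral_mono (hunorm.const_mul β)
      (integrable_finsetSum _ fun i _ => integrable_finsetSum _ fun j _ => hI3 i j)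
      fun ω => hβ (u n ω)
  have hfin : (d + d * d) * ε' ≤ ε := by
    have : (d + d * d + 1) * ε' = ε := by rw [hε']; field_simp
    linarith
  have := mul_le_mul_of_nonneg_right hfin (by linarith : 0 ≤ 1 + V)
  linarith

/-- Mean-square convergence of implicit TD(λ), written as an explicit recursion with damped
step sizes, along a finite Markov chain whose `n`-step transition probabilities converge. -/
theorem IsMarkovChain.convergesInMeanSquare {d : ℕ} {γ lam β : ℝ} (hz : IsMarkovChain K ℙ z)
    (hK : K ∈ Matrix.rowStochastic ℝ Z)
    (hlim : ∀ y y', Tendsto (fun n => (K ^ n) y y') atTop (𝓝 (ν y')))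
    (hγ0 : 0 ≤ γ) (hγ1 : γ ≤ 1) (hκ0 : 0 ≤ lam * γ) (hκ1 : lam * γ < 1)
    {ψ : Z → EuclideanSpace ℝ (Fin d)} (hψ : ∀ y, ‖ψ y‖ ≤ 1) {r : Z → ℝ} (hβ0 : 0 < β)
    (hβ : ∀ v : EuclideanSpace ℝ (Fin d),
      β * ‖v‖ ^ 2 ≤ ∑ i, ∑ j, tdMatrix K ν (lam * γ) γ ψ i j * (v i * v j))
    {wstar : EuclideanSpace ℝ (Fin d)}
    (hw : (tdMatrix K ν (lam * γ) γ ψ *ᵥ fun j => wstar j) =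
      fun i => traceCorrelation K ν (lam * γ) (fun y => ψ y i) r)
    {α : ℕ → ℝ} (hα : Tendsto α atTop (𝓝 0)) (hα0 : ∀ n, 1 ≤ n → 0 ≤ α n)
    (hsum : Tendsto (fun n => ∑ k ∈ Finset.range n, α k) atTop atTop)
    {w₁ : EuclideanSpace ℝ (Fin d)} {w : ℕ → Ω → EuclideanSpace ℝ (Fin d)} (hw1 : ∀ ω, w 1 ω = w₁)
    (hrec : ∀ n, 1 ≤ n → ∀ ω, w (n + 1) ω = w n ω +
      (α n / (1 + α n * ‖eligibilityTrace γ lam ψ (fun i => z i ω) n‖ ^ 2)) •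
        ((r (z n ω) - inner ℝ (ψ (z n ω)) (w n ω) + γ * inner ℝ (ψ (z (n + 1) ω)) (w n ω)) •
          eligibilityTrace γ lam ψ (fun i => z i ω) n)) :
    ConvergesInMeanSquare ℙ w wstar := by
  have hwf : ∀ n, 1 ≤ n → (w n).FactorsThrough (history z n) := by
    intro n hn
    induction n, hn using Nat.le_induction with
    | base => intro ω ω' _; rw [hw1, hw1]
    | succ n hn ih =>
      intro ω ω' e
      have h1 := factorsThrough_history_mono (Nat.le_succ n) ih e
      have h2 := factorsThrough_history_mono (Nat.le_succ n)
        (factorsThrough_eligibilityTrace γ lam ψ z n) e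
      have h3 : z n ω = z n ω' := factorsThrough_history_self hn (Nat.le_succ n) id e
      have h4 : z (n + 1) ω = z (n + 1) ω' :=
        factorsThrough_history_self (by omega) le_rfl id e
      rw [hrec n hn, hrec n hn, h1, h2, h3, h4]
  set u : ℕ → Ω → EuclideanSpace ℝ (Fin d) := fun n ω => w n ω - wstar with hu
  have huf : ∀ n, 1 ≤ n → (u n).FactorsThrough (history z n) := fun n hn ω ω' e => by
    simp only [hu, hwf n hn e]
  have hint : ∀ n, 1 ≤ n → Integrable (fun ω => ‖u n ω‖ ^ 2) ℙ := fun n hn =>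
    hz.integrable (n := n) fun ω ω' e => by simp only [huf n hn e]
  refine ⟨hint, ?_⟩
  obtain ⟨R, hR0, hR⟩ := exists_forall_abs_le r
  set D : ℝ := 1 / (1 - lam * γ) with hD
  have hD0 : 0 ≤ D := by
    have : 0 < 1 - lam * γ := by linarith
    positivity
  have heD : ∀ n ω, ‖eligibilityTrace γ lam ψ (fun i => z i ω) n‖ ≤ D := fun n ω =>
    norm_eligibilityTrace_le hκ0 hκ1 hψ _ n
  have hin : ∀ y v, |inner ℝ (ψ y) v| ≤ ‖v‖ := fun y v =>
    (abs_real_inner_le_norm _ _).trans (mul_le_of_le_one_left (norm_nonneg _) (hψ y))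
  have hdiff : ∀ y y' v, |-inner ℝ (ψ y) v + γ * inner ℝ (ψ y') v| ≤ 2 * ‖v‖ := fun y y' v => by
    have h1 := hin y v
    have h2 : |γ * inner ℝ (ψ y') v| ≤ ‖v‖ := by
      rw [abs_mul, abs_of_nonneg hγ0]
      exact (mul_le_of_le_one_left (abs_nonneg _) hγ1).trans (hin y' v)
    have h3 := abs_add_le (-inner ℝ (ψ y) v) (γ * inner ℝ (ψ y') v)
    rw [abs_neg] at h3
    linarith
  set F : ℕ → Ω → EuclideanSpace ℝ (Fin d) → EuclideanSpace ℝ (Fin d) := fun n ω v =>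
    (r (z n ω) - inner ℝ (ψ (z n ω)) (wstar + v) + γ * inner ℝ (ψ (z (n + 1) ω)) (wstar + v)) •
      eligibilityTrace γ lam ψ (fun i => z i ω) n with hF
  set C : ℝ := D ^ 2 + (R + 2 * ‖wstar‖) * D + 2 * D with hC
  have hC1 : 0 ≤ (R + 2 * ‖wstar‖) * D := by positivity
  have hC2 : 0 ≤ D ^ 2 := by positivity
  refine tendsto_integral_norm_sq_of_lag (F := F) (α := α) (C := C)
    (a := fun n ω => α n / (1 + α n * ‖eligibilityTrace γ lam ψ (fun i => z i ω) n‖ ^ 2))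
    hβ0 (by positivity) hα hα0 hsum ?_ ?_ ?_ ?_ ?_ ?_ hint ?_ ?_
  · intro n hn ω
    have := hα0 n hn
    positivity
  · intro n hn ω
    have := hα0 n hn
    exact div_le_self this (le_add_of_nonneg_right (by positivity))
  · intro n hn ω
    have h0 := hα0 n hn
    set e := ‖eligibilityTrace γ lam ψ (fun i => z i ω) n‖ with he
    have h1 : 1 ≤ 1 + α n * e ^ 2 := le_add_of_nonneg_right (by positivity)
    have h2 : α n - α n / (1 + α n * e ^ 2) = e ^ 2 * α n ^ 2 / (1 + α n * e ^ 2) := by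
      field_simp
      ring
    have h3 : e ^ 2 ≤ D ^ 2 := by
      have := heD n ω
      gcongr
    calc α n - α n / (1 + α n * e ^ 2) ≤ e ^ 2 * α n ^ 2 := by
          rw [h2]
          exact div_le_self (by positivity) h1
      _ ≤ C * α n ^ 2 := by
          gcongr
          linarith
  · intro n hn ω
    simp only [hF, add_zero, norm_smul, Real.norm_eq_abs]
    have h1 : |r (z n ω) - inner ℝ (ψ (z n ω)) wstar + γ * inner ℝ (ψ (z (n + 1) ω)) wstar| ≤
        R + 2 * ‖wstar‖ := by
      have h2 := abs_add_le (r (z n ω))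
        (-inner ℝ (ψ (z n ω)) wstar + γ * inner ℝ (ψ (z (n + 1) ω)) wstar)
      rw [← add_assoc, ← sub_eq_add_neg] at h2
      have h3 := hdiff (z n ω) (z (n + 1) ω) wstar
      have h4 := hR (z n ω)
      linarith
    have h2 := mul_le_mul h1 (heD n ω) (norm_nonneg _) (by positivity)
    linarith
  · intro n hn ω v v'
    have e : F n ω v - F n ω v' = (-inner ℝ (ψ (z n ω)) (v - v') +
        γ * inner ℝ (ψ (z (n + 1) ω)) (v - v')) •
          eligibilityTrace γ lam ψ (fun i => z i ω) n := by
      simp only [hF]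
      rw [← sub_smul]
      congr 1
      simp only [inner_add_right, inner_sub_right]
      ring
    rw [e, norm_smul, Real.norm_eq_abs]
    calc _ ≤ 2 * ‖v - v'‖ * D :=
          mul_le_mul (hdiff _ _ _) (heD n ω) (norm_nonneg _) (by positivity)
      _ = 2 * D * ‖v - v'‖ := by ring
      _ ≤ C * ‖v - v'‖ := by
          gcongr
          linarith
  · intro n hn ω
    simp only [hF, add_sub_cancel]
    rw [hrec n hn, add_sub_right_comm]
  · intro m n hm hmn
    refine hz.integrable (n := n + 1) fun ω ω' e => ?_
    have h1 := factorsThrough_history_mono (show m ≤ n + 1 by omega) (hwf m hm) e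
    have h2 := factorsThrough_history_mono (Nat.le_succ n)
      (factorsThrough_eligibilityTrace γ lam ψ z n) e
    have h3 : z n ω = z n ω' := factorsThrough_history_self (by omega) (Nat.le_succ n) id e
    have h4 : z (n + 1) ω = z (n + 1) ω' := factorsThrough_history_self (by omega) le_rfl id e
    simp only [hF]
    rw [h1, h2, h3, h4]
  · exact fun ε hε => hz.exists_lag_integral_inner_le hK hlim hκ0 hκ1 hβ hw huf hε

end Chain

/-! ### The state-action chain of a decision process -/

/-- The transition matrix of the pairs (state, action) under a policy. -/
def stateActionMatrix {X A : Type*} [Fintype X] [Fintype A] (M : FiniteMDP X A)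
    (p : FinitePolicy X A) : Matrix (X × A) (X × A) ℝ :=
  fun q q' => M.trans q.2 q.1 q'.1 * p.prob q'.1 q'.2

/-- The law of the pair (state, action) when the state has law `μ`. -/
def stateActionLaw {X A : Type*} [Fintype A] (p : FinitePolicy X A) (μ : X → ℝ) (q : X × A) : ℝ :=
  μ q.1 * p.prob q.1 q.2

lemma sum_stateActionLaw_mul {X A : Type*} [Fintype X] [Fintype A] (p : FinitePolicy X A)
    (μ f : X → ℝ) : ∑ q, stateActionLaw p μ q * f q.1 = ∑ y, μ y * f y := by
  rw [Fintype.sum_prod_type]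
  refine Finset.sum_congr rfl fun y _ => ?_
  simp only [stateActionLaw]
  rw [← Finset.sum_mul, ← Finset.mul_sum, p.prob_sum, mul_one]

lemma stateMatrix_mem_rowStochastic {X A : Type*} [Fintype X] [DecidableEq X] [Fintype A]
    (M : FiniteMDP X A) (p : FinitePolicy X A) : stateMatrix M p ∈ Matrix.rowStochastic ℝ X := by
  rw [Matrix.mem_rowStochastic_iff_sum]
  refine ⟨fun y y' => Finset.sum_nonneg fun b _ =>
    mul_nonneg (p.prob_nonneg y b) (M.trans_nonneg b y y'), fun y => ?_⟩
  simp only [stateMatrix]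
  rw [Finset.sum_comm]
  simp only [← Finset.mul_sum, M.trans_sum, mul_one, p.prob_sum]

lemma stateActionLaw_vecMul {X A : Type*} [Fintype X] [Fintype A] {M : FiniteMDP X A}
    {p : FinitePolicy X A} {μ : X → ℝ} (hμ : μ ᵥ* stateMatrix M p = μ) :
    stateActionLaw p μ ᵥ* stateActionMatrix M p = stateActionLaw p μ := by
  funext q'
  have h := congrFun hμ q'.1
  simp only [Matrix.vecMul, dotProduct, stateMatrix, Finset.mul_sum] at h
  simp only [Matrix.vecMul, dotProduct, stateActionLaw, stateActionMatrix]
  rw [Fintype.sum_prod_type]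
  conv_rhs => rw [← h, Finset.sum_mul]
  refine Finset.sum_congr rfl fun y _ => ?_
  rw [Finset.sum_mul]
  exact Finset.sum_congr rfl fun b _ => by ring

section StateAction

variable {X A : Type*} [Fintype X] [DecidableEq X] [Fintype A] [DecidableEq A]
  (M : FiniteMDP X A) (p : FinitePolicy X A)

lemma stateActionMatrix_mem_rowStochastic :
    stateActionMatrix M p ∈ Matrix.rowStochastic ℝ (X × A) := by
  rw [Matrix.mem_rowStochastic_iff_sum]
  refine ⟨fun q q' => mul_nonneg (M.trans_nonneg _ _ _) (p.prob_nonneg _ _), fun q => ?_⟩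
  rw [Fintype.sum_prod_type]
  simp only [stateActionMatrix, ← Finset.mul_sum, p.prob_sum, mul_one, M.trans_sum]

lemma stateActionMatrix_pow_succ_apply (k : ℕ) (q q' : X × A) :
    (stateActionMatrix M p ^ (k + 1)) q q' =
      (∑ y, M.trans q.2 q.1 y * (stateMatrix M p ^ k) y q'.1) * p.prob q'.1 q'.2 := by
  induction k generalizing q' with
  | zero => simp [stateActionMatrix, Matrix.one_apply]
  | succ k ih =>
    rw [pow_succ, Matrix.mul_apply, Fintype.sum_prod_type, pow_succ (stateMatrix M p)]
    simp only [ih, Matrix.mul_apply, stateActionMatrix]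
    simp only [stateMatrix, Finset.mul_sum, Finset.sum_mul]
    rw [Finset.sum_comm_cycle]
    exact Finset.sum_congr rfl fun y _ => Finset.sum_congr rfl fun y' _ =>
      Finset.sum_congr rfl fun b _ => by ring

variable {M p}

lemma tendsto_stateActionMatrix_pow {μ : X → ℝ}
    (hlim : ∀ y y', Tendsto (fun n => (stateMatrix M p ^ n) y y') atTop (𝓝 (μ y')))
    (q q' : X × A) :
    Tendsto (fun n => (stateActionMatrix M p ^ n) q q') atTop (𝓝 (stateActionLaw p μ q')) := by
  rw [← tendsto_add_atTop_iff_nat 1]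
  simp only [stateActionMatrix_pow_succ_apply]
  refine Tendsto.mul_const _ ?_
  have h := tendsto_finsetSum (Finset.univ : Finset X) fun y _ =>
    (hlim y q'.1).const_mul (M.trans q.2 q.1 y)
  rwa [← Finset.sum_mul, M.trans_sum, one_mul] at h

end StateAction

lemma steadyTrace_apply {X A : Type*} {d : ℕ} {γ lam : ℝ} (h0 : 0 ≤ lam * γ)
    (h1 : lam * γ < 1) {φ : X → EuclideanSpace ℝ (Fin d)} (hφ : ∀ y, ‖φ y‖ ≤ 1) (path : ℤ → X × A)
    (i : Fin d) :
    steadyTrace γ lam φ path i = ∑' k : ℕ, (lam * γ) ^ k * φ (path (-(k : ℤ))).1 i := by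
  have hs : Summable fun k : ℕ => (lam * γ) ^ k • φ (path (-(k : ℤ))).1 := by
    refine Summable.of_norm_bounded (summable_geometric_of_lt_one h0 h1) fun k => ?_
    rw [norm_smul, Real.norm_eq_abs, abs_of_nonneg (pow_nonneg h0 k)]
    exact mul_le_of_le_one_right (pow_nonneg h0 k) (hφ _)
  simpa [steadyTrace] using (EuclideanSpace.proj (𝕜 := ℝ) i).map_tsum hs

/-- Steady-state expectations against the infinite trace are discounted sums. -/
lemma hasSum_integral_steadyTrace_mul {X A : Type*} [Finite X] [MeasurableSpace X]
    [MeasurableSingletonClass X] [MeasurableSpace A] {Q : Measure (ℤ → X × A)}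
    [IsProbabilityMeasure Q] {d : ℕ} {γ lam : ℝ} (h0 : 0 ≤ lam * γ) (h1 : lam * γ < 1)
    {φ : X → EuclideanSpace ℝ (Fin d)} (hφ : ∀ y, ‖φ y‖ ≤ 1) (i : Fin d)
    {H : (ℤ → X × A) → ℝ} (hH : Measurable H) {C : ℝ} (hC : ∀ path, |H path| ≤ C) :
    HasSum (fun k : ℕ => (lam * γ) ^ k * ∫ path, φ (path (-(k : ℤ))).1 i * H path ∂Q)
      (∫ path, steadyTrace γ lam φ path i * H path ∂Q) := by
  have hφm : ∀ k : ℕ, Measurable fun path : ℤ → X × A => φ (path (-(k : ℤ))).1 i := fun k =>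
    (measurable_of_finite fun y => φ y i).comp (measurable_fst.comp (measurable_pi_apply _))
  have hbd : ∀ (k : ℕ) (path : ℤ → X × A),
      ‖(lam * γ) ^ k * (φ (path (-(k : ℤ))).1 i * H path)‖ ≤ (lam * γ) ^ k * C := by
    intro k path
    rw [norm_mul, norm_pow, Real.norm_of_nonneg h0, norm_mul]
    refine mul_le_mul_of_nonneg_left ?_ (pow_nonneg h0 k)
    calc _ ≤ 1 * C := mul_le_mul ((PiLp.norm_apply_le _ i).trans (hφ _)) (hC path)
          (abs_nonneg _) zero_le_one
      _ = C := one_mul C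
  have hint : ∀ k : ℕ, Integrable (fun path : ℤ → X × A =>
      (lam * γ) ^ k * (φ (path (-(k : ℤ))).1 i * H path)) Q := fun k =>
    Integrable.of_bound (((hφm k).mul hH).const_mul _).aestronglyMeasurable _
      (Eventually.of_forall (hbd k))
  have h := hasSum_integral_of_summable_integral_norm hint
    (Summable.of_nonneg_of_le (fun k => integral_nonneg fun path => norm_nonneg _) (fun k => by
      simpa using integral_mono (hint k).norm (integrable_const _) (hbd k))
      ((summable_geometric_of_lt_one h0 h1).mul_right C))
  have e : ∀ path : ℤ → X × A, ∑' k : ℕ, (lam * γ) ^ k * (φ (path (-(k : ℤ))).1 i * H path) =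
      steadyTrace γ lam φ path i * H path := fun path => by
    rw [steadyTrace_apply h0 h1 hφ, ← tsum_mul_right]
    exact tsum_congr fun k => (mul_assoc _ _ _).symm
  simpa only [integral_const_mul, e] using h

section Trajectory

variable {X A : Type*} [Fintype X] [MeasurableSpace X] [Fintype A] [MeasurableSpace A]
  {M : FiniteMDP X A} {p : FinitePolicy X A}

lemma IsTrajectoryFrom.isMarkovChain {Ω : Type*} [MeasurableSpace Ω] {ℙ : Measure Ω}
    {x : ℕ → Ω → X} {a : ℕ → Ω → A} (h : IsTrajectoryFrom M p ℙ x a 1) :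
    IsMarkovChain (stateActionMatrix M p) ℙ fun n ω => (x n ω, a n ω) where
  measurable n hn := (h.measurable_state n hn).prodMk (h.measurable_action n hn)
  step n hn y := by
    have := h.step n hn (fun i => (y i).1) (fun i => (y i).2)
    simpa only [Prod.ext_iff, stateActionMatrix] using this

lemma IsSteadyStateLaw.isMarkovChain {μ : X → ℝ} {Q : Measure (ℤ → X × A)}
    (hQ : IsSteadyStateLaw M p μ Q) (m : ℤ) :
    IsMarkovChain (stateActionMatrix M p) Q fun n path => path (m + n) where
  measurable n _ := measurable_pi_apply _
  step n hn y := by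
    have h := (hQ.trajectory (m + 1)).step (m + n) (by omega) (fun i => (y (i - m).toNat).1)
      (fun i => (y (i - m).toNat).2)
    have e : ∀ (k : ℕ) (path : ℤ → X × A), (∀ i ∈ Set.Icc (m + 1) (m + k),
        (path i).1 = (y (i - m).toNat).1 ∧ (path i).2 = (y (i - m).toNat).2) ↔
        ∀ i ∈ Set.Icc 1 k, path (m + i) = y i := by
      intro k path
      refine ⟨fun H i hi => ?_, fun H i hi => ?_⟩
      · have h1 := H (m + i) ⟨by have := hi.1; omega, by have := hi.2; omega⟩
        rw [add_sub_cancel_left, Int.toNat_natCast] at h1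
        exact Prod.ext h1.1 h1.2
      · have h1 := hi.1
        have h2 := hi.2
        have h3 := H (i - m).toNat ⟨by omega, by omega⟩
        rw [show m + ((i - m).toNat : ℤ) = i by omega] at h3
        rw [h3]
        exact ⟨rfl, rfl⟩
    have e1 : m + (n : ℤ) + 1 = m + (n + 1 : ℕ) := by push_cast; ring
    simp only [e1, e, add_sub_cancel_left, Int.toNat_natCast] at h
    exact h

variable [MeasurableSingletonClass X] [MeasurableSingletonClass A] {μ : X → ℝ}
  {Q : Measure (ℤ → X × A)} [IsProbabilityMeasure Q]

lemma IsSteadyStateLaw.integral_apply (hQ : IsSteadyStateLaw M p μ Q) (m : ℤ) (g : X × A → ℝ) :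
    ∫ path, g (path m) ∂Q = ∑ q, stateActionLaw p μ q * g q := by
  have hm : Measurable fun path : ℤ → X × A => path m := measurable_pi_apply m
  have := Measure.isProbabilityMeasure_map (μ := Q) hm.aemeasurable
  rw [← integral_map (μ := Q) hm.aemeasurable (f := g) Integrable.of_finite.aestronglyMeasurable,
    integral_fintype Integrable.of_finite]
  refine Finset.sum_congr rfl fun q _ => ?_
  rw [map_measureReal_apply hm (measurableSet_singleton q), smul_eq_mul, stateActionLaw,
    ← hQ.marginal m q.1, ← (hQ.trajectory m).first_action]
  congr 2
  ext path
  exact Prod.ext_iff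

lemma IsSteadyStateLaw.integral_mul_apply [DecidableEq X] [DecidableEq A]
    (hQ : IsSteadyStateLaw M p μ Q) (m : ℤ) (k : ℕ) (f h : X × A → ℝ) :
    ∫ path, f (path m) * h (path (m + k)) ∂Q =
      ∑ q, stateActionLaw p μ q * (f q * ((stateActionMatrix M p ^ k) *ᵥ h) q) := by
  have hz := hQ.isMarkovChain (m - 1)
  have h1 := hz.integral_mul_apply_add (n := 1) le_rfl
    (factorsThrough_history_self le_rfl le_rfl f) h k
  have e1 : m - 1 + ((1 : ℕ) : ℤ) = m := by push_cast; ring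
  have e2 : m - 1 + ((1 + k : ℕ) : ℤ) = m + k := by push_cast; ring
  simp only [e1, e2] at h1
  rw [h1, hQ.integral_apply m fun q => f q * ((stateActionMatrix M p ^ k) *ᵥ h) q]

variable [DecidableEq X] [DecidableEq A] {d : ℕ} {γ lam : ℝ} {φ : X → EuclideanSpace ℝ (Fin d)}

lemma IsSteadyStateLaw.steadyVector_eq (hQ : IsSteadyStateLaw M p μ Q) (h0 : 0 ≤ lam * γ)
    (h1 : lam * γ < 1) (hφ : ∀ y, ‖φ y‖ ≤ 1) (r : X → A → ℝ) :
    steadyVector Q r (steadyTrace γ lam φ) = fun i =>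
      traceCorrelation (stateActionMatrix M p) (stateActionLaw p μ) (lam * γ)
        (fun q => φ q.1 i) fun q => r q.1 q.2 := by
  funext i
  obtain ⟨C, -, hC⟩ := exists_forall_abs_le fun q : X × A => r q.1 q.2
  have hm : Measurable fun path : ℤ → X × A => r (path 0).1 (path 0).2 :=
    (measurable_of_finite fun q : X × A => r q.1 q.2).comp (measurable_pi_apply 0)
  have h := hasSum_integral_steadyTrace_mul (Q := Q) h0 h1 hφ i hm fun path => hC (path 0)
  simp only [steadyVector, mul_comm (r _ _)]
  rw [← h.tsum_eq, traceCorrelation]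
  refine tsum_congr fun k => ?_
  have e := hQ.integral_mul_apply (-(k : ℤ)) k (fun q => φ q.1 i) fun q => r q.1 q.2
  rw [neg_add_cancel] at e
  rw [e]

lemma IsSteadyStateLaw.steadyMatrix_eq (hQ : IsSteadyStateLaw M p μ Q) (h0 : 0 ≤ lam * γ)
    (h1 : lam * γ < 1) (hφ : ∀ y, ‖φ y‖ ≤ 1) :
    steadyMatrix Q γ φ (steadyTrace γ lam φ) =
      tdMatrix (stateActionMatrix M p) (stateActionLaw p μ) (lam * γ) γ fun q => φ q.1 := by
  funext i j
  set f : X × A → ℝ := fun q => φ q.1 i with hf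
  set h : X × A → ℝ := fun q => φ q.1 j with hh
  have hm : ∀ (g : X × A → ℝ) (n : ℤ), Measurable fun path : ℤ → X × A => g (path n) :=
    fun g n => (measurable_of_finite g).comp (measurable_pi_apply n)
  obtain ⟨C, hC0, hC⟩ := exists_forall_abs_le h
  have hbd : ∀ path : ℤ → X × A, |h (path 0) - γ * h (path 1)| ≤ C + |γ| * C := fun path => by
    refine (abs_sub _ _).trans (add_le_add (hC _) ?_)
    rw [abs_mul]
    exact mul_le_mul_of_nonneg_left (hC _) (abs_nonneg γ)
  have hsum := hasSum_integral_steadyTrace_mul (Q := Q) h0 h1 hφ i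
    (H := fun path => h (path 0) - γ * h (path 1)) ((hm h 0).sub ((hm h 1).const_mul γ)) hbd
  have e0 : ∀ path : ℤ → X × A, steadyTrace γ lam φ path i * φ (path 0).1 j -
      γ * (steadyTrace γ lam φ path i * φ (path 1).1 j) =
      steadyTrace γ lam φ path i * (h (path 0) - γ * h (path 1)) := fun path => by
    simp only [hh]; ring
  change _ = traceCorrelation (stateActionMatrix M p) (stateActionLaw p μ) (lam * γ) f
    (h - γ • stateActionMatrix M p *ᵥ h)
  simp only [steadyMatrix, e0]
  rw [← hsum.tsum_eq, traceCorrelation]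
  refine tsum_congr fun k => ?_
  congr 1
  have hint : ∀ n : ℤ, Integrable (fun path : ℤ → X × A => f (path (-(k : ℤ))) * h (path n)) Q := by
    intro n
    obtain ⟨B, hB0, hB⟩ := exists_forall_abs_le f
    refine Integrable.of_bound ((hm f _).mul (hm h n)).aestronglyMeasurable (B * C)
      (Eventually.of_forall fun path => ?_)
    rw [norm_mul]
    exact mul_le_mul (hB _) (hC _) (abs_nonneg _) hB0
  have e1 : ∀ path : ℤ → X × A, φ (path (-(k : ℤ))).1 i * (h (path 0) - γ * h (path 1)) =
      f (path (-(k : ℤ))) * h (path 0) - γ * (f (path (-(k : ℤ))) * h (path 1)) := fun path => by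
    simp only [hf]; ring
  have e2 := hQ.integral_mul_apply (-(k : ℤ)) k f h
  have e3 := hQ.integral_mul_apply (-(k : ℤ)) (k + 1) f h
  rw [neg_add_cancel] at e2
  rw [Nat.cast_succ, neg_add_cancel_left] at e3
  simp only [e1]
  rw [integral_sub (hint 0) ((hint 1).const_mul γ), integral_const_mul, e2, e3, Finset.mul_sum,
    ← Finset.sum_sub_distrib]
  refine Finset.sum_congr rfl fun q _ => ?_
  rw [Matrix.mulVec_sub, Matrix.mulVec_smul, Matrix.mulVec_mulVec, ← pow_succ]
  simp only [Pi.sub_apply, Pi.smul_apply, smul_eq_mul]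
  ring

end Trajectory

/-! ### Features, step sizes, and the case `λ = 0` -/

lemma exists_inner_ne_zero_of_rank_featureMatrix {X : Type*} [Fintype X] {d : ℕ}
    {φ : X → EuclideanSpace ℝ (Fin d)} (hrank : (featureMatrix φ).rank = d)
    {v : EuclideanSpace ℝ (Fin d)} (hv : v ≠ 0) : ∃ y, inner ℝ (φ y) v ≠ 0 := by
  by_contra! h
  have h1 := LinearMap.finrank_range_add_finrank_ker (featureMatrix φ).mulVecLin
  rw [← Matrix.rank, hrank, Module.finrank_fin_fun] at h1
  have hker : LinearMap.ker (featureMatrix φ).mulVecLin = ⊥ :=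
    Submodule.finrank_eq_zero.1 (by omega)
  have hmem : (fun j => v j) ∈ LinearMap.ker (featureMatrix φ).mulVecLin := by
    rw [LinearMap.mem_ker]
    funext y
    have := h y
    rw [PiLp.inner_apply] at this
    simpa [Matrix.mulVec, dotProduct, featureMatrix, mul_comm] using this
  rw [hker, Submodule.mem_bot] at hmem
  exact hv (by ext j; exact congrFun hmem j)

lemma sum_stateActionLaw_mul_inner_sq_pos {X A : Type*} [Fintype X] [Fintype A]
    (p : FinitePolicy X A) {μ : X → ℝ} (hμ : ∀ y, 0 < μ y) {d : ℕ}
    {φ : X → EuclideanSpace ℝ (Fin d)} (hrank : (featureMatrix φ).rank = d)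
    {v : EuclideanSpace ℝ (Fin d)} (hv : v ≠ 0) :
    0 < ∑ q : X × A, stateActionLaw p μ q * (inner ℝ (φ q.1) v) ^ 2 := by
  rw [sum_stateActionLaw_mul p μ fun y => (inner ℝ (φ y) v) ^ 2]
  obtain ⟨y, hy⟩ := exists_inner_ne_zero_of_rank_featureMatrix hrank hv
  exact Finset.sum_pos' (fun y _ => mul_nonneg (hμ y).le (sq_nonneg _))
    ⟨y, Finset.mem_univ y, mul_pos (hμ y) (by positivity)⟩

lemma tendsto_stepSize_zero {c s : ℝ} (hs : 0 < s) {α : ℕ → ℝ}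
    (hα : ∀ n : ℕ, 1 ≤ n → α n = c * (n : ℝ) ^ (-s)) : Tendsto α atTop (𝓝 0) := by
  have h := ((tendsto_rpow_neg_atTop hs).comp tendsto_natCast_atTop_atTop).const_mul c
  rw [mul_zero] at h
  refine h.congr' ?_
  filter_upwards [eventually_ge_atTop 1] with n hn
  exact (hα n hn).symm

lemma tendsto_sum_stepSize_atTop {c s : ℝ} (hc : 0 < c) (hs : s ≤ 1) {α : ℕ → ℝ}
    (hα : ∀ n : ℕ, 1 ≤ n → α n = c * (n : ℝ) ^ (-s)) :
    Tendsto (fun n => ∑ k ∈ Finset.range n, α k) atTop atTop := by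
  have hns : ¬ Summable fun n : ℕ => α (n + 1) := by
    intro h
    have h1 : Summable fun n : ℕ => ((n + 1 : ℕ) : ℝ) ^ (-s) := by
      refine (h.mul_left c⁻¹).congr fun n => ?_
      rw [hα _ (by omega), inv_mul_cancel_left₀ hc.ne']
    rw [summable_nat_add_iff (f := fun n : ℕ => (n : ℝ) ^ (-s)) 1, Real.summable_nat_rpow] at h1
    linarith
  rw [not_summable_iff_tendsto_nat_atTop_of_nonneg fun n => by
    rw [hα _ (by omega)]; positivity] at hns
  rw [← tendsto_add_atTop_iff_nat 1]
  simp only [Finset.sum_range_succ']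
  exact tendsto_atTop_add_const_right _ _ hns

lemma steadyTrace_zero {X A : Type*} {d : ℕ} (γ : ℝ) (φ : X → EuclideanSpace ℝ (Fin d)) :
    (steadyTrace γ 0 φ : (ℤ → X × A) → _) = fun path => φ (path 0).1 := by
  funext path
  rw [steadyTrace, tsum_eq_single 0 fun k hk => by simp [hk]]
  simp

lemma isTDZeroSolution_iff {X A : Type*} {d : ℕ} [MeasurableSpace X] [MeasurableSpace A]
    (Q : Measure (ℤ → X × A)) (γ : ℝ) (φ : X → EuclideanSpace ℝ (Fin d)) (r : X → A → ℝ)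
    (v : EuclideanSpace ℝ (Fin d)) :
    IsTDZeroSolution Q γ φ r v ↔ IsTDLambdaSolution Q γ 0 φ r v := by
  rw [IsTDZeroSolution, IsTDLambdaSolution, steadyTrace_zero]

lemma isImplicitTDLambda_zero_iff {X A : Type*} {d : ℕ} (γ : ℝ) (φ : X → EuclideanSpace ℝ (Fin d))
    (r : X → A → ℝ) (α : ℕ → ℝ) (x : ℕ → X) (a : ℕ → A) (w : ℕ → EuclideanSpace ℝ (Fin d)) :
    IsImplicitTDLambda γ 0 φ r α x a w ↔ IsImplicitTDZero γ φ r α x a w := by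
  refine forall_congr' fun n => forall_congr' fun hn => ?_
  obtain ⟨n, rfl⟩ : ∃ m, n = m + 1 := ⟨n - 1, by omega⟩
  simp [eligibilityTrace]

lemma eligibilityTrace_comp {Z X : Type*} {d : ℕ} (γ lam : ℝ) (φ : X → EuclideanSpace ℝ (Fin d))
    (g : Z → X) (z : ℕ → Z) (n : ℕ) :
    eligibilityTrace γ lam (fun y => φ (g y)) z n =
      eligibilityTrace γ lam φ (fun i => g (z i)) n := by
  induction n with
  | zero => rfl
  | succ n ih => rw [eligibilityTrace, eligibilityTrace, ih]

/-- The implicit recursion solved for the new iterate. The trace terms combine, since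
`e n = φ (x n) + λ γ e (n - 1)`, and only the temporal difference at `w n` remains. -/
lemma IsImplicitTDLambda.eq_explicit {X A : Type*} {d : ℕ} {γ lam : ℝ}
    {φ : X → EuclideanSpace ℝ (Fin d)} {r : X → A → ℝ} {α : ℕ → ℝ} {x : ℕ → X} {a : ℕ → A}
    {w : ℕ → EuclideanSpace ℝ (Fin d)} (hw : IsImplicitTDLambda γ lam φ r α x a w) {n : ℕ}
    (hn : 1 ≤ n) (hα : 0 ≤ α n) :
    w (n + 1) = w n + (α n / (1 + α n * ‖eligibilityTrace γ lam φ x n‖ ^ 2)) •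
      ((r (x n) (a n) - inner ℝ (φ (x n)) (w n) + γ * inner ℝ (φ (x (n + 1))) (w n)) •
        eligibilityTrace γ lam φ x n) := by
  have h := eq_add_smul_of_implicit hα (hw n hn)
  have e : inner ℝ (eligibilityTrace γ lam φ x n) (w n) = inner ℝ (φ (x n)) (w n) +
      lam * γ * inner ℝ (eligibilityTrace γ lam φ x (n - 1)) (w n) := by
    obtain ⟨n, rfl⟩ : ∃ m, n = m + 1 := ⟨n - 1, by omega⟩
    rw [eligibilityTrace, inner_add_left, real_inner_smul_left, Nat.add_sub_cancel]
  rw [e] at h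
  rw [h]
  congr 3
  ring

/-! ### Convergence of implicit TD(0) and TD(λ) -/

theorem theorem1
    {X A : Type*} [Fintype X] [DecidableEq X] [MeasurableSpace X] [MeasurableSingletonClass X]
    [Fintype A] [MeasurableSpace A] [MeasurableSingletonClass A]
    (M : FiniteMDP X A) (p : FinitePolicy X A)
    (hirr : (stateMatrix M p).IsIrreducible) (haper : IsAperiodicMatrix (stateMatrix M p))
    (μ : X → ℝ) (hμ : IsStationaryDistribution (stateMatrix M p) μ)
    (Q : Measure (ℤ → X × A)) [IsProbabilityMeasure Q] (hQ : IsSteadyStateLaw M p μ Q)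
    (γ : ℝ) (hγ0 : 0 < γ) (hγ1 : γ < 1)
    {d : ℕ} (φ : X → EuclideanSpace ℝ (Fin d)) (hφ : ∀ y, ‖φ y‖ ≤ 1)
    (hrank : (featureMatrix φ).rank = d)
    {Ω : Type*} [MeasurableSpace Ω] (ℙ : Measure Ω) [IsProbabilityMeasure ℙ]
    (x : ℕ → Ω → X) (a : ℕ → Ω → A) (hxa : IsTrajectoryFrom M p ℙ x a 1)
    (c : ℝ) (hc : 0 < c) (s : ℝ) (hs : s ∈ Set.Ioc (1 / 2 : ℝ) 1)
    (α : ℕ → ℝ) (hα : ∀ n : ℕ, 1 ≤ n → α n = c * (n : ℝ) ^ (-s)) :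
    (∃ wstar : EuclideanSpace ℝ (Fin d),
      (∀ v, IsTDZeroSolution Q γ φ M.reward v ↔ v = wstar) ∧
      ∀ (w₁ : EuclideanSpace ℝ (Fin d)) (w : ℕ → Ω → EuclideanSpace ℝ (Fin d)),
        (∀ ω, w 1 ω = w₁) →
        (∀ ω, IsImplicitTDZero γ φ M.reward α (fun n => x n ω) (fun n => a n ω)
          (fun n => w n ω)) →
        ConvergesInMeanSquare ℙ w wstar) ∧
    (∀ lam ∈ Set.Icc (0 : ℝ) 1, ∃ wstar : EuclideanSpace ℝ (Fin d),
      (∀ v, IsTDLambdaSolution Q γ lam φ M.reward v ↔ v = wstar) ∧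
      ∀ (w₁ : EuclideanSpace ℝ (Fin d)) (w : ℕ → Ω → EuclideanSpace ℝ (Fin d)),
        (∀ ω, w 1 ω = w₁) →
        (∀ ω, IsImplicitTDLambda γ lam φ M.reward α (fun n => x n ω) (fun n => a n ω)
          (fun n => w n ω)) →
        ConvergesInMeanSquare ℙ w wstar) := by
  classical
  have hPst := stateMatrix_mem_rowStochastic M p
  obtain ⟨N, hN⟩ := hirr.exists_pow_pos_of_aperiodic haper
  have hK := stateActionMatrix_mem_rowStochastic M p
  have hlim := tendsto_stateActionMatrix_pow (M := M) (p := p)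
    (tendsto_pow_apply_of_pow_pos hPst hN hμ)
  have hα0 : ∀ n, 1 ≤ n → 0 ≤ α n := fun n hn => by
    rw [hα n hn]; positivity
  have hlambda : ∀ lam ∈ Set.Icc (0 : ℝ) 1, ∃ wstar : EuclideanSpace ℝ (Fin d),
      (∀ v, IsTDLambdaSolution Q γ lam φ M.reward v ↔ v = wstar) ∧
      ∀ (w₁ : EuclideanSpace ℝ (Fin d)) (w : ℕ → Ω → EuclideanSpace ℝ (Fin d)),
        (∀ ω, w 1 ω = w₁) →
        (∀ ω, IsImplicitTDLambda γ lam φ M.reward α (fun n => x n ω) (fun n => a n ω)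
          (fun n => w n ω)) →
        ConvergesInMeanSquare ℙ w wstar := by
    intro lam hlam
    have hκ0 : 0 ≤ lam * γ := mul_nonneg hlam.1 hγ0.le
    have hκγ : lam * γ ≤ γ := mul_le_of_le_one_left hγ0.le hlam.2
    have hκ1 : lam * γ < 1 := hκγ.trans_lt hγ1
    obtain ⟨β, hβ0, hβ⟩ := exists_pos_mul_norm_sq_le_tdMatrix hK
      (fun q => mul_nonneg (hμ.nonneg q.1) (p.prob_nonneg q.1 q.2))
      (stateActionLaw_vecMul hμ.stationary) hκ0 hκγ hγ1
      (fun v hv => sum_stateActionLaw_mul_inner_sq_pos p (hμ.pos hN) hrank hv)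
    obtain ⟨wstar, hwstar⟩ := Matrix.existsUnique_mulVec_eq_of_coercive hβ0 hβ fun i =>
      traceCorrelation (stateActionMatrix M p) (stateActionLaw p μ) (lam * γ)
        (fun q => φ q.1 i) fun q => M.reward q.1 q.2
    refine ⟨wstar, fun v => ?_, fun w₁ w hw1 hw => ?_⟩
    · rw [IsTDLambdaSolution, hQ.steadyMatrix_eq hκ0 hκ1 hφ, hQ.steadyVector_eq hκ0 hκ1 hφ]
      exact hwstar v
    · refine hxa.isMarkovChain.convergesInMeanSquare hK hlim hγ0.le hγ1.le hκ0 hκ1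
        (fun q => hφ q.1) hβ0 hβ ((hwstar wstar).2 rfl)
        (tendsto_stepSize_zero (by linarith [hs.1]) hα) hα0 (tendsto_sum_stepSize_atTop hc hs.2 hα)
        hw1 fun n hn ω => ?_
      rw [eligibilityTrace_comp γ lam φ Prod.fst]
      exact (hw ω).eq_explicit hn (hα0 n hn)
  refine ⟨?_, hlambda⟩
  obtain ⟨wstar, h1, h2⟩ := hlambda 0 ⟨le_rfl, zero_le_one⟩
  exact ⟨wstar, fun v => (isTDZeroSolution_iff Q γ φ M.reward v).trans (h1 v), fun w₁ w hw1 hw =>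
    h2 w₁ w hw1 fun ω => (isImplicitTDLambda_zero_iff _ _ _ _ _ _ _).2 (hw ω)⟩
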